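/- Let $\mathbb H$ be an infinite-dimensional separable real Hilbert space (for instance $L^2([0,1])$), with inner product $\langle\cdot,\cdot\rangle$ and norm $\|\cdot\|$. Let $\beta\in\mathbb H$, and let $(X_i,\varepsilon_i)_{i\ge1}$ be i.i.d. pairs, where $X_i$ is a centred random element of $\mathbb H$ with $\mathbb E\|X_i\|^2<\infty$, and $\varepsilon_i$ is a centred real random variable with variance $\sigma^2$, independent of $X_i$. Put $Y_i=\langle\beta,X_i\rangle+\varepsilon_i$. Assume (H1): $\tau_p:=\mathbb E|\varepsilon_1|^p<\infty$ for some $p>4$. Let $\theta>0$ and let $n\ge3$ be an integer. Let $\Gamma f=\mathbb E[\langle f,X_1\rangle X_1]$ be the covariance operator, with eigenvalues $\lambda_1\ge\lambda_2\ge\cdots$, and let $\Gamma_nf=\frac1n\sum_{i=1}^n\langle f,X_i\rangle X_i$ be its empirical counterpart, with eigenvalues $\hat\lambda_1\ge\hat\lambda_2\ge\cdots$ and an orthonormal family of associated eigenvectors $\hat\psi_1,\hat\psi_2,\dots$, chosen as a measurable function of $(X_1,\dots,X_n)$. Put $$\|f\|_{\Gamma_n}^2=\frac1n\sum_{i=1}^n\langle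 f,X_i\rangle^2,\qquad \gamma_n(t)=\frac1n\sum_{i=1}^n(Y_i-\langle t,X_i\rangle)^2,\qquad \hat g=\frac1n\sum_{i=1}^nY_iX_i,$$ $$\hat\beta_m=\sum_{j=1}^m\frac{\langle\hat g,\hat\psi_j\rangle}{\hat\lambda_j}\hat\psi_j,\qquad \mathrm{pen}^{(kv)}(m)=(1+\theta)\frac{\sigma^2m}{n},\qquad \mathfrak s_n=\frac2{n^2}\Bigl(1-\frac1{\ln^2n}\Bigr),$$ and let $\hat\Pi_m$ be the orthogonal projector onto $\hat S_m=\mathrm{span}\{\hat\psi_1,\dots,\hat\psi_m\}$. Let $\hat N_n$ be the largest integer $N\ge1$ such that $N\le20\sqrt{n/\ln^3n}$ and $\hat\lambda_N\ge\mathfrak s_n$, and let $N_n$ be the largest integer $N\ge1$ such that $N\le20\sqrt{n/\ln^3n}$ and $\lambda_N\ge n^{-2}$ (each is $0$ if there is no such $N$); put $\mathcal M_n=\{1,\dots,N_n\}$. Let $\hat m^{(kv)}$ be a (measurable) minimizer of $\gamma_n(\hat\beta_m)+\mathrm{pen}^{(kv)}(m)$ over $m\in\{1,\dots,\hat N_n\}$,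 and $\widetilde\beta^{(kv)}=\hat\beta_{\hat m^{(kv)}}$, with $\widetilde\beta^{(kv)}=0$ if $\hat N_n=0$. Then there are constants $C,C'>0$ depending only on $\theta$ and $p$ such that $$\mathbb E\bigl[\|\widetilde\beta^{(kv)}-\beta\|_{\Gamma_n}^2\bigr]\le C\inf_{m\in\mathcal M_n}\Bigl\{\mathbb E\bigl[\|\beta-\hat\Pi_m\beta\|_{\Gamma_n}^2\bigr]+\mathrm{pen}^{(kv)}(m)\Bigr\}+\frac{C'}{n}\Bigl(\frac{\tau_p}{\sigma^p}\,\sigma^2+\|\beta\|^2\Bigr),$$ where $\inf\emptyset=+\infty$, and the term $\frac{\tau_p}{\sigma^p}\sigma^2$ is read as $0$ if $\sigma=0$. In particular (as $\tau_p\ge\sigma^p$), when $\sigma>0$ the bound holds with last term $C''(\sigma^2+\|\beta\|^2)/n$, where $C''=C'\tau_p/\sigma^p$ depends only on $\theta$, $p$ and the ratio $\tau_p/\sigma^p$. -/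

import Mathlib

open MeasureTheory ProbabilityTheory
open scoped RealInnerProductSpace ENNReal

noncomputable section

namespace FPCR

variable {H : Type*} [NormedAddCommGroup H] [InnerProductSpace ℝ H]

/-- `lam`, `ψ` are the eigenvalues, counted with multiplicity and in decreasing order, and
orthonormal eigenvectors of `T`; nothing of `T` is left outside the family `ψ`. Indices start at
`0`, so that `lam 0`, `ψ 0` are the first eigenvalue and the first eigenvector. An orthonormal
basis of eigenvectors, in decreasing order of the eigenvalues, is such a family. -/
structure IsEigensystem (T : H → H) (lam : ℕ → ℝ) (ψ : ℕ → H) : Prop where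
  orthonormal : Orthonormal ℝ ψ
  eigen : ∀ j, T (ψ j) = lam j • ψ j
  antitone : Antitone lam
  complete : ∀ f : H, (∀ j, ⟪f, ψ j⟫ = 0) → T f = 0

/-- Covariance operator `f ↦ E[⟨f, X⟩ X]` of a (centred) random element `X`. -/
def covOp {Ω : Type*} [MeasurableSpace Ω] (P : Measure Ω) (X : Ω → H) (f : H) : H :=
  ∫ ω, ⟪f, X ω⟫ • X ω ∂P

/-- Empirical covariance operator of the design `x`. -/
def empCov {n : ℕ} (x : Fin n → H) (f : H) : H :=
  (1 / (n : ℝ)) • ∑ i, ⟪f, x i⟫ • x i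

/-- Squared empirical semi-norm `‖f‖²_{Γ_n}`. -/
def empNormSq {n : ℕ} (x : Fin n → H) (f : H) : ℝ :=
  (1 / (n : ℝ)) * ∑ i, ⟪f, x i⟫ ^ 2

/-- Least squares contrast `γ_n(t)`. -/
def contrast {n : ℕ} (x : Fin n → H) (y : Fin n → ℝ) (t : H) : ℝ :=
  (1 / (n : ℝ)) * ∑ i, (y i - ⟪t, x i⟫) ^ 2

/-- Empirical cross-covariance `ĝ`. -/
def crossCov {n : ℕ} (x : Fin n → H) (y : Fin n → ℝ) : H :=
  (1 / (n : ℝ)) • ∑ i, y i • x i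

/-- The least squares estimator on the span of the first `m` eigenvectors. -/
def estimator {n : ℕ} (x : Fin n → H) (y : Fin n → ℝ) (lam : ℕ → ℝ) (ψ : ℕ → H) (m : ℕ) : H :=
  ∑ j ∈ Finset.range m, (⟪crossCov x y, ψ j⟫ / lam j) • ψ j

/-- The span of the first `m` vectors of the family `ψ`. -/
def firstSpan (ψ : ℕ → H) (m : ℕ) : Submodule ℝ H :=
  Submodule.span ℝ (Set.range fun j : Fin m => ψ j)

instance (ψ : ℕ → H) (m : ℕ) : FiniteDimensional ℝ (firstSpan ψ m) :=
  FiniteDimensional.span_of_finite ℝ (Set.finite_range _)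

/-- Orthogonal projector onto the span of the first `m` vectors of the family `ψ`. -/
def proj (ψ : ℕ → H) (m : ℕ) : H →L[ℝ] H := (firstSpan ψ m).starProjection

/-- The threshold `𝔰_n` for the empirical eigenvalues. -/
def threshold (n : ℕ) : ℝ := 2 / (n : ℝ) ^ 2 * (1 - 1 / Real.log n ^ 2)

/-- The largest `N ≥ 1` with `N ≤ 20 √(n / ln³ n)` and `N`-th eigenvalue at least `s`;
it is `0` if there is none. (For `n ≥ 2` the set is bounded.) -/
def maxDim (n : ℕ) (s : ℝ) (lam : ℕ → ℝ) : ℕ :=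
  sSup {N : ℕ | 1 ≤ N ∧ (N : ℝ) ≤ 20 * √((n : ℝ) / Real.log n ^ 3) ∧ s ≤ lam (N - 1)}

/-- The penalty `(1 + θ) σ² m / n`, for a known noise variance `σ²`. -/
def pen (θ σ : ℝ) (n m : ℕ) : ℝ := (1 + θ) * (σ ^ 2 / n) * m

/-- The penalized criterion. -/
def crit {n : ℕ} (θ σ : ℝ) (x : Fin n → H) (y : Fin n → ℝ) (lam : ℕ → ℝ) (ψ : ℕ → H)
    (m : ℕ) : ℝ :=
  contrast x y (estimator x y lam ψ m) + pen θ σ n m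

/-- `m` minimizes the penalized criterion over `{1, …, N}`, where `N` is the maximal empirical
dimension; if there is no model at all (`N = 0`), then `m = 0`, so that the estimator of
dimension `m` is the empty sum `0`. -/
def IsSelected {n : ℕ} (θ σ : ℝ) (x : Fin n → H) (y : Fin n → ℝ) (lam : ℕ → ℝ) (ψ : ℕ → H)
    (m : ℕ) : Prop :=
  (maxDim n (threshold n) lam = 0 → m = 0) ∧
  (1 ≤ maxDim n (threshold n) lam →
    m ∈ Finset.Icc 1 (maxDim n (threshold n) lam) ∧
    ∀ k ∈ Finset.Icc 1 (maxDim n (threshold n) lam), crit θ σ x y lam ψ m ≤ crit θ σ x y lam ψ k)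

end FPCR

end

universe u v

/-! Fix the design. The residual `resid β ψ m` is orthogonal, also for `⟨Γ_n ·, ·⟩`, to the first
`m` empirical eigenvectors. So the loss in dimension `m` is exactly B_m + V_m, where B_m is the
squared empirical norm of the residual and V_m (`noiseSq`) is that of the projected noise. The
contrast there is B_m − V_m + 2ν(r_m) plus a term free of `m`, with r_m the residual and ν the noise
functional. Since 2|ν(r_m)| ≤ B_m/2 + 2W_m, where W_m (`residNoise`) is ν(r_m)²/B_m, minimality of
the criterion gives the oracle bound up to the excesses of V_m over (1 + θ/2)σ²m/n and of W_m over
θσ²m/(16n) (`loss_le`).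

These excesses cost O(1/n) in expectation. For a fixed design, nV_m is a quadratic form in the noise
whose matrix is dominated by a projector, and nW_m is the square of a normalized linear form. Their
centred moments come from one martingale recursion (`moment_recursion`), without decoupling. They
yield excesses of order m^(1−p/4) for V and m^(1−p/2) for W (`quadratic_form_tail`,
`linear_form_tail`). The second sequence is summable over all dimensions when p > 4, but the first
need not be. V is monotone in `m`, however, so it suffices to control it on a geometric grid, along
which any negative power is summable. Rounding up to the grid turns the level 1 + θ/4 into 1 + θ/2.
The sum of all excesses (`totalNoise`) no longer involves the selected dimension. Independence of
design and noise then allows integrating over the noise with the design frozen.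

The random model collection is handled by comparing the selected dimension with min(m, N̂)
(`selected_loss_le`). If m exceeds N̂, the discarded eigenvalues lie below the threshold, hence
below 2/n, and the bias grows by at most 2‖β‖²/n. No comparison of empirical and population spectra
is needed. -/

namespace FPCR

/-! ### Elementary inequalities for real powers. -/

theorem abs_one_add_rpow_le {q : ℝ} (hq : 2 ≤ q) (t : ℝ) :
    |1 + t| ^ q ≤ 1 + q * t + ((1 + 4 * q) ^ q + 4 * q ^ 2) * (t ^ 2 + |t| ^ q) := by
  have hq0 : 0 < q := by linarith
  have hA : 0 ≤ (1 + 4 * q) ^ q := by positivity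
  have htq : 0 ≤ |t| ^ q := by positivity
  -- For small `t`, Bernoulli applied to (1 + t)⁻¹ gives (1 + t)^(−q) ≥ 1 − z with z = qt/(1 + t),
  -- and 1/(1 − z) ≤ 1 + z + 2z² for z ≤ 1/2. For large `t`, 1 ≤ 4q|t| makes |t|^q dominate.
  rcases le_or_gt (|t| * (4 * q)) 1 with h | h
  · have hlt : |t| ≤ 1 / 8 := by nlinarith [abs_nonneg t]
    obtain ⟨h1, h2⟩ := abs_le.mp hlt
    have hw : 0 < 1 + t := by linarith
    have hs : -1 ≤ -t / (1 + t) := by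
      rw [le_div_iff₀ hw]; linarith
    have hb := one_add_mul_self_le_rpow_one_add hs (p := q) (by linarith)
    have e1 : 1 + -t / (1 + t) = (1 + t)⁻¹ := by field_simp; ring
    rw [e1, Real.inv_rpow hw.le] at hb
    rw [abs_of_pos hw]
    set z := q * t / (1 + t) with hz
    have hz1 : 1 + q * (-t / (1 + t)) = 1 - z := by rw [hz]; ring
    rw [hz1] at hb
    have hW : 0 < (1 + t) ^ q := by positivity
    have hmul : (1 - z) * (1 + t) ^ q ≤ 1 := by
      calc (1 - z) * (1 + t) ^ q ≤ ((1 + t) ^ q)⁻¹ * (1 + t) ^ q :=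
            mul_le_mul_of_nonneg_right hb hW.le
        _ = 1 := inv_mul_cancel₀ hW.ne'
    have hzt : z * (1 + t) = q * t := by rw [hz]; field_simp
    have hqt : |q * t| ≤ 1 / 4 := by
      rw [abs_mul, abs_of_pos hq0]; linarith
    obtain ⟨h3, h4⟩ := abs_le.mp hqt
    have hzle : z ≤ 1 / 2 := by
      rw [hz, div_le_iff₀ hw]; linarith
    have hzq : z ≤ q * t := by
      rw [hz, div_le_iff₀ hw]; nlinarith [mul_nonneg hq0.le (sq_nonneg t)]
    have hz2 : z ^ 2 ≤ 2 * (q * t) ^ 2 := by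
      rw [← hzt, mul_pow]
      have : (1 : ℝ) ≤ 2 * (1 + t) ^ 2 := by nlinarith
      nlinarith [sq_nonneg z]
    have hfin : (1 + t) ^ q ≤ 1 + z + 2 * z ^ 2 := by
      have : 1 ≤ (1 - z) * (1 + z + 2 * z ^ 2) := by nlinarith [sq_nonneg z]
      exact le_of_mul_le_mul_left (hmul.trans this) (by linarith)
    nlinarith [mul_nonneg hA (sq_nonneg t), mul_nonneg hA htq,
      mul_nonneg (sq_nonneg q) htq]
  · have h1 : |1 + t| ≤ (1 + 4 * q) * |t| := by
      have := abs_add_le 1 t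
      rw [abs_one] at this
      linarith
    have h2 : |1 + t| ^ q ≤ (1 + 4 * q) ^ q * |t| ^ q := by
      rw [← Real.mul_rpow (by positivity) (abs_nonneg t)]
      exact Real.rpow_le_rpow (abs_nonneg _) h1 hq0.le
    have h3 : 0 ≤ 1 + q * t + 4 * q ^ 2 * t ^ 2 := by
      nlinarith [sq_nonneg (1 + q * t), sq_nonneg (q * t)]
    nlinarith [mul_nonneg hA (sq_nonneg t), mul_nonneg (sq_nonneg q) htq]

/-- Homogeneous form of the previous expansion, with t = b/a. The term linear in `b` is kept exact
because it will vanish in expectation. -/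
theorem abs_add_rpow_le {q : ℝ} (hq : 2 ≤ q) (a b : ℝ) :
    |a + b| ^ q ≤ |a| ^ q + q * (|a| ^ (q - 2) * a * b)
      + ((1 + 4 * q) ^ q + 4 * q ^ 2) * (|a| ^ (q - 2) * b ^ 2 + |b| ^ q) := by
  have hq0 : 0 < q := by linarith
  set C := (1 + 4 * q) ^ q + 4 * q ^ 2 with hC
  have hC1 : 1 ≤ C := by
    have : 0 ≤ (1 + 4 * q) ^ q := by positivity
    nlinarith
  rcases eq_or_ne a 0 with rfl | ha
  · have h1 : 0 ≤ |b| ^ q := by positivity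
    have h2 : 0 ≤ |(0 : ℝ)| ^ (q - 2) * b ^ 2 := by positivity
    have h3 : |(0 : ℝ)| ^ q = 0 := by rw [abs_zero, Real.zero_rpow hq0.ne']
    rw [zero_add, h3]
    nlinarith
  · have hpos : 0 < |a| := abs_pos.mpr ha
    have h := mul_le_mul_of_nonneg_left (abs_one_add_rpow_le hq (b / a))
      (show 0 ≤ |a| ^ q by positivity)
    have e0 : |a| ^ q = |a| ^ (q - 2) * a ^ 2 := by
      rw [← sq_abs a, ← Real.rpow_natCast |a| 2, ← Real.rpow_add hpos]; norm_num
    have e1 : |a| ^ q * |1 + b / a| ^ q = |a + b| ^ q := by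
      rw [← Real.mul_rpow hpos.le (abs_nonneg _), ← abs_mul]
      congr 2; field_simp
    have e2 : |a| ^ q * |b / a| ^ q = |b| ^ q := by
      rw [← Real.mul_rpow hpos.le (abs_nonneg _), ← abs_mul]
      congr 2; field_simp
    have e3 : |a| ^ q * (b / a) ^ 2 = |a| ^ (q - 2) * b ^ 2 := by
      rw [e0]; field_simp
    have e4 : |a| ^ q * (q * (b / a)) = q * (|a| ^ (q - 2) * a * b) := by
      rw [e0]; field_simp
    rw [e1] at h
    calc |a + b| ^ q ≤ _ := h
      _ = |a| ^ q + |a| ^ q * (q * (b / a))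
          + C * (|a| ^ q * (b / a) ^ 2 + |a| ^ q * |b / a| ^ q) := by ring
      _ = _ := by rw [e4, e3, e2]

theorem rpow_mul_le_add {q s : ℝ} (hs0 : 0 ≤ s) (hsq : s ≤ q) {a b : ℝ} (ha : 0 ≤ a)
    (hb : 0 ≤ b) : a ^ (q - s) * b ^ s ≤ a ^ q + b ^ q := by
  rcases hs0.eq_or_lt with rfl | hs
  · simp only [sub_zero, Real.rpow_zero, mul_one]
    have : 0 ≤ b ^ q := by positivity
    linarith
  set c := max a b with hc
  have hc0 : 0 ≤ c := ha.trans (le_max_left _ _)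
  have h1 : a ^ (q - s) * b ^ s ≤ c ^ (q - s) * c ^ s :=
    mul_le_mul (Real.rpow_le_rpow ha (le_max_left _ _) (by linarith))
      (Real.rpow_le_rpow hb (le_max_right _ _) hs.le) (by positivity) (by positivity)
  have h2 : c ^ (q - s) * c ^ s = c ^ q := by
    rw [← Real.rpow_add_of_nonneg hc0 (by linarith) hs.le]; congr 1; ring
  have h3 : c ^ q ≤ a ^ q + b ^ q := by
    rcases max_choice a b with h | h <;> rw [hc, h]
    · have : 0 ≤ b ^ q := by positivity
      linarith
    · have : 0 ≤ a ^ q := by positivity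
      linarith
  linarith

/-! ### Moments of martingales with predictable weights. -/

section Moments

variable {Ω : Type*} [MeasurableSpace Ω] {P : Measure Ω}

theorem integrable_rpow_mul {q s : ℝ} (hs0 : 0 ≤ s) (hsq : s ≤ q) {U L : Ω → ℝ}
    (hU : Measurable U) (hL : Measurable L) (hUq : Integrable (fun ω => |U ω| ^ q) P)
    (hLq : Integrable (fun ω => |L ω| ^ q) P) :
    Integrable (fun ω => |U ω| ^ (q - s) * |L ω| ^ s) P := by
  refine (hUq.add hLq).mono' (by fun_prop) (ae_of_all _ fun ω => ?_)
  rw [Real.norm_of_nonneg (by positivity)]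
  exact rpow_mul_le_add hs0 hsq (abs_nonneg _) (abs_nonneg _)

/-- Hölder with the conjugate exponents q/(q − 2) and q/2. -/
theorem integral_rpow_mul_sq_le {q : ℝ} (hq : 2 < q) {U L : Ω → ℝ} (hU : Measurable U)
    (hL : Measurable L) (hUq : Integrable (fun ω => |U ω| ^ q) P)
    (hLq : Integrable (fun ω => |L ω| ^ q) P) :
    ∫ ω, |U ω| ^ (q - 2) * L ω ^ 2 ∂P
      ≤ (∫ ω, |U ω| ^ q ∂P) ^ (1 - 2 / q) * (∫ ω, |L ω| ^ q ∂P) ^ (2 / q) := by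
  have hq0 : 0 < q := by linarith
  have hq2 : 0 < q - 2 := by linarith
  have hconj : (q / (q - 2)).HolderConjugate (q / 2) := by
    rw [Real.holderConjugate_iff]
    refine ⟨by rw [lt_div_iff₀ hq2]; linarith, by field_simp; ring⟩
  have e1 : ∀ ω, (|U ω| ^ (q - 2)) ^ (q / (q - 2)) = |U ω| ^ q := fun ω => by
    rw [← Real.rpow_mul (abs_nonneg _)]; congr 1; field_simp
  have e2 : ∀ ω, (L ω ^ 2) ^ (q / 2) = |L ω| ^ q := fun ω => by
    rw [← sq_abs, ← Real.rpow_natCast, ← Real.rpow_mul (abs_nonneg _)]; congr 1; push_cast; ring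
  have m1 : MemLp (fun ω => |U ω| ^ (q - 2)) (ENNReal.ofReal (q / (q - 2))) P := by
    rw [← integrable_norm_rpow_iff (Measurable.aestronglyMeasurable (by fun_prop)) (by simpa using by positivity) (by simp),
      ENNReal.toReal_ofReal (by positivity)]
    refine hUq.congr (ae_of_all _ fun ω => ?_)
    simp only
    rw [Real.norm_of_nonneg (by positivity), e1]
  have m2 : MemLp (fun ω => L ω ^ 2) (ENNReal.ofReal (q / 2)) P := by
    rw [← integrable_norm_rpow_iff (Measurable.aestronglyMeasurable (by fun_prop)) (by simpa using by positivity) (by simp),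
      ENNReal.toReal_ofReal (by positivity)]
    refine hLq.congr (ae_of_all _ fun ω => ?_)
    simp only
    rw [Real.norm_of_nonneg (by positivity), e2]
  have h := integral_mul_le_Lp_mul_Lq_of_nonneg hconj
    (ae_of_all P fun ω => by simp only [Pi.zero_apply]; positivity)
    (ae_of_all P fun ω => by simp only [Pi.zero_apply]; positivity) m1 m2
  simp only [e1, e2] at h
  have e3 : 1 / (q / (q - 2)) = 1 - 2 / q := by field_simp
  have e4 : 1 / (q / 2) = 2 / q := by field_simp
  rwa [e3, e4] at h

theorem integral_sq_le [IsProbabilityMeasure P] {q : ℝ} (hq : 2 < q) {L : Ω → ℝ}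
    (hL : Measurable L) (hLq : Integrable (fun ω => |L ω| ^ q) P) :
    ∫ ω, L ω ^ 2 ∂P ≤ (∫ ω, |L ω| ^ q ∂P) ^ (2 / q) := by
  have h := integral_rpow_mul_sq_le (P := P) hq (U := fun _ => 1) measurable_const hL
    (by simp) hLq
  simpa using h

/-- Increment of the moment of order `q` when an independent centred term is added. -/
theorem moment_add_le [IsProbabilityMeasure P] {q : ℝ} (hq : 2 < q) {U L ζ : Ω → ℝ}
    (hU : Measurable U) (hL : Measurable L) (hζ : Measurable ζ)
    (hind : IndepFun (fun ω => (U ω, L ω)) ζ P)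
    (hUq : Integrable (fun ω => |U ω| ^ q) P) (hLq : Integrable (fun ω => |L ω| ^ q) P)
    (hζq : Integrable (fun ω => |ζ ω| ^ q) P) (hζ0 : ∫ ω, ζ ω ∂P = 0) :
    Integrable (fun ω => |U ω + L ω * ζ ω| ^ q) P ∧
    ∫ ω, |U ω + L ω * ζ ω| ^ q ∂P ≤ ∫ ω, |U ω| ^ q ∂P
      + ((1 + 4 * q) ^ q + 4 * q ^ 2) * ((∫ ω, |U ω| ^ (q - 2) * L ω ^ 2 ∂P) * (∫ ω, ζ ω ^ 2 ∂P)
        + (∫ ω, |L ω| ^ q ∂P) * ∫ ω, |ζ ω| ^ q ∂P) := by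
  have hq0 : 0 < q := by linarith
  set C := (1 + 4 * q) ^ q + 4 * q ^ 2 with hC
  have hC0 : 0 ≤ C := by positivity
  have iζ2 : Integrable (fun ω => ζ ω ^ 2) P := by
    have := integrable_rpow_mul (P := P) (q := q) (s := 2) (by norm_num) hq.le (U := fun _ => 1)
      measurable_const hζ (by simp) hζq
    simpa using this
  have iζ1 : Integrable ζ P := by
    have := integrable_rpow_mul (P := P) (q := q) (s := 1) (by norm_num) (by linarith)
      (U := fun _ => 1) measurable_const hζ (by simp) hζq
    simp only [abs_one, Real.one_rpow, Real.rpow_one, one_mul] at this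
    exact (integrable_norm_iff hζ.aestronglyMeasurable).mp this
  have iA : Integrable (fun ω => |U ω| ^ (q - 2) * U ω * L ω) P := by
    have := integrable_rpow_mul (P := P) (q := q) (s := 1) (by norm_num) (by linarith) hU hL hUq hLq
    refine this.mono (by fun_prop) (ae_of_all _ fun ω => le_of_eq ?_)
    rw [norm_mul, norm_mul, norm_mul, Real.norm_of_nonneg (by positivity : 0 ≤ |U ω| ^ (q - 2)),
      Real.norm_of_nonneg (by positivity : 0 ≤ |U ω| ^ (q - 1)), Real.rpow_one, Real.norm_eq_abs,
      Real.norm_eq_abs, Real.norm_eq_abs, abs_abs]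
    congr 1
    rw [show q - 1 = q - 2 + 1 by ring, Real.rpow_add_of_nonneg (abs_nonneg _) (by linarith)
      zero_le_one, Real.rpow_one]
  have iB : Integrable (fun ω => |U ω| ^ (q - 2) * L ω ^ 2) P := by
    have := integrable_rpow_mul (P := P) (q := q) (s := 2) (by norm_num) hq.le hU hL hUq hLq
    simpa using this
  have indA : IndepFun (fun ω => |U ω| ^ (q - 2) * U ω * L ω) ζ P :=
    hind.comp (φ := fun u : ℝ × ℝ => |u.1| ^ (q - 2) * u.1 * u.2) (by fun_prop) measurable_id
  have indB : IndepFun (fun ω => |U ω| ^ (q - 2) * L ω ^ 2) (fun ω => ζ ω ^ 2) P :=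
    hind.comp (φ := fun u : ℝ × ℝ => |u.1| ^ (q - 2) * u.2 ^ 2) (ψ := fun z : ℝ => z ^ 2)
      (by fun_prop) (by fun_prop)
  have indD : IndepFun (fun ω => |L ω| ^ q) (fun ω => |ζ ω| ^ q) P :=
    hind.comp (φ := fun u : ℝ × ℝ => |u.2| ^ q) (ψ := fun z : ℝ => |z| ^ q)
      (by fun_prop) (by fun_prop)
  have jA := indA.integrable_mul iA iζ1
  have jB := indB.integrable_mul iB iζ2
  have jD := indD.integrable_mul hLq hζq
  have kA := indA.integral_mul_eq_mul_integral iA.1 iζ1.1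
  have kB := indB.integral_mul_eq_mul_integral iB.1 iζ2.1
  have kD := indD.integral_mul_eq_mul_integral hLq.1 hζq.1
  -- The first-order term vanishes: `ζ` is centred and independent of `(U, L)`.
  rw [hζ0, mul_zero] at kA
  have hpt : ∀ ω, |U ω + L ω * ζ ω| ^ q ≤ |U ω| ^ q
      + q * ((fun ω => |U ω| ^ (q - 2) * U ω * L ω) * ζ) ω
      + C * (((fun ω => |U ω| ^ (q - 2) * L ω ^ 2) * fun ω => ζ ω ^ 2) ω
        + ((fun ω => |L ω| ^ q) * fun ω => |ζ ω| ^ q) ω) := fun ω => by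
    refine (abs_add_rpow_le hq.le (U ω) (L ω * ζ ω)).trans (le_of_eq ?_)
    simp only [Pi.mul_apply]
    rw [abs_mul, Real.mul_rpow (abs_nonneg _) (abs_nonneg _)]
    ring
  have iR := (hUq.add (jA.const_mul q)).add ((jB.add jD).const_mul C)
  have iL : Integrable (fun ω => |U ω + L ω * ζ ω| ^ q) P := by
    refine iR.mono' (Measurable.aestronglyMeasurable (by fun_prop)) (ae_of_all _ fun ω => ?_)
    rw [Real.norm_of_nonneg (by positivity)]
    exact hpt ω
  refine ⟨iL, (integral_mono iL iR hpt).trans (le_of_eq ?_)⟩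
  rw [← kB, ← kD]
  have h1 := integral_add (hUq.add (jA.const_mul q)) ((jB.add jD).const_mul C)
  have h2 := integral_add hUq (jA.const_mul q)
  have h3 := integral_add jB jD
  have h4 := integral_const_mul (μ := P) q ((fun ω => |U ω| ^ (q - 2) * U ω * L ω) * ζ)
  have h5 := integral_const_mul (μ := P) C
    (((fun ω => |U ω| ^ (q - 2) * L ω ^ 2) * fun ω => ζ ω ^ 2)
        + ((fun ω => |L ω| ^ q) * fun ω => |ζ ω| ^ q))
  rw [kA, mul_zero] at h4
  simp only [Pi.add_apply] at h1 h2 h3 h4 h5 ⊢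
  rw [h1, h2, h5, h3, h4, add_zero]

/-- Closes the induction of `moment_recursion` with r = q/2. With a = 2Cx and b = 2Cy, both a^r +
b^r and a^r + a^(r−1)b are at most (a + b)^r. Averaging the two is what requires the factor 2 in 2C.
-/
theorem rpow_add_mul_le {r x y C : ℝ} (hr : 1 < r) (hC : 1 ≤ C) (hx : 0 ≤ x) (hy : 0 ≤ y) :
    (2 * C * x) ^ r + C * ((2 * C * x) ^ (r - 1) * y + y ^ r) ≤ (2 * C * (x + y)) ^ r := by
  have hC0 : 0 < C := by linarith
  set a := 2 * C * x with ha
  set b := 2 * C * y with hb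
  have ha0 : 0 ≤ a := by positivity
  have hb0 : 0 ≤ b := by positivity
  have h1 : a ^ r + b ^ r ≤ (a + b) ^ r := Real.add_rpow_le_rpow_add ha0 hb0 hr.le
  have h2 : a ^ r + a ^ (r - 1) * b ≤ (a + b) ^ r := by
    rcases ha0.eq_or_lt with h | h
    · rw [← h, Real.zero_rpow (by linarith), Real.zero_rpow (by linarith)]; simp; positivity
    · have h3 := one_add_mul_self_le_rpow_one_add (s := b / a) (p := r)
        (by have : 0 ≤ b / a := by positivity
            linarith) hr.le
      have h4 : (a + b) ^ r = a ^ r * (1 + b / a) ^ r := by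
        rw [← Real.mul_rpow ha0 (by positivity)]; congr 1; field_simp
      have h5 : a ^ r = a ^ (r - 1) * a := by
        rw [← Real.rpow_add_one h.ne']; congr 1; ring
      have h6 : a ^ r + a ^ (r - 1) * b = a ^ r * (1 + b / a) := by
        rw [h5]; field_simp
      rw [h6, h4]
      refine mul_le_mul_of_nonneg_left (le_trans ?_ h3) (by positivity)
      have : 0 ≤ b / a := by positivity
      nlinarith
  have h7 : 2 * C * y ^ r ≤ b ^ r := by
    rw [hb, Real.mul_rpow (by positivity) hy]
    refine mul_le_mul_of_nonneg_right ?_ (by positivity)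
    exact Real.self_le_rpow_of_one_le (by linarith) hr.le
  have h8 : 2 * C * (x + y) = a + b := by rw [ha, hb]; ring
  rw [h8]
  have h9 : a ^ (r - 1) * b = 2 * (C * (a ^ (r - 1) * y)) := by rw [hb]; ring
  nlinarith

/-- Moment bound for a martingale whose increments are products of a predictable weight and an
independent centred variable. -/
theorem moment_recursion [IsProbabilityMeasure P] {q : ℝ} (hq : 2 < q) {U L ζ : ℕ → Ω → ℝ}
    {a : ℕ → ℝ} {t s : ℝ} (ha : ∀ k, 0 ≤ a k) (ht : 0 ≤ t) (hs : 0 ≤ s)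
    (hU : ∀ k, Measurable (U k)) (hL : ∀ k, Measurable (L k)) (hζ : ∀ k, Measurable (ζ k))
    (hU0 : ∀ ω, U 0 ω = 0) (hUs : ∀ k ω, U (k + 1) ω = U k ω + L k ω * ζ k ω)
    (hind : ∀ k, IndepFun (fun ω => (U k ω, L k ω)) (ζ k) P)
    (hLq : ∀ k, Integrable (fun ω => |L k ω| ^ q) P)
    (hLt : ∀ k, ∫ ω, |L k ω| ^ q ∂P ≤ a k ^ (q / 2) * t)
    (hζq : ∀ k, Integrable (fun ω => |ζ k ω| ^ q) P)
    (hζs : ∀ k, ∫ ω, |ζ k ω| ^ q ∂P ≤ s)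
    (hζ0 : ∀ k, ∫ ω, ζ k ω ∂P = 0) (k : ℕ) :
    Integrable (fun ω => |U k ω| ^ q) P ∧
    ∫ ω, |U k ω| ^ q ∂P
      ≤ (2 * ((1 + 4 * q) ^ q + 4 * q ^ 2) * ∑ i ∈ Finset.range k, a i) ^ (q / 2) * (t * s) := by
  have hq0 : 0 < q := by linarith
  have hC1 : 1 ≤ (1 + 4 * q) ^ q + 4 * q ^ 2 := by
    have : 0 ≤ (1 + 4 * q) ^ q := by positivity
    nlinarith
  induction k with
  | zero => simp [hU0, Real.zero_rpow hq0.ne', Real.zero_rpow (show q / 2 ≠ 0 by positivity)]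
  | succ k ih =>
    obtain ⟨ihI, ih⟩ := ih
    obtain ⟨h1, h2⟩ := moment_add_le hq (hU k) (hL k) (hζ k) (hind k) ihI (hLq k) (hζq k) (hζ0 k)
    simp only [hUs]
    refine ⟨h1, h2.trans ?_⟩
    rw [Finset.sum_range_succ]
    set C := (1 + 4 * q) ^ q + 4 * q ^ 2 with hC
    set A := ∑ i ∈ Finset.range k, a i with hA
    have hA0 : 0 ≤ A := Finset.sum_nonneg fun i _ => ha i
    have hak := ha k
    have hkey := rpow_add_mul_le (r := q / 2) (by linarith) hC1 hA0 (ha k)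
    have hX : ∫ ω, |U k ω| ^ (q - 2) * L k ω ^ 2 ∂P
        ≤ ((2 * C * A) ^ (q / 2) * (t * s)) ^ (1 - 2 / q) * (a k ^ (q / 2) * t) ^ (2 / q) := by
      refine (integral_rpow_mul_sq_le hq (hU k) (hL k) ihI (hLq k)).trans ?_
      refine mul_le_mul (Real.rpow_le_rpow (integral_nonneg fun ω => by positivity) ih ?_)
        (Real.rpow_le_rpow (integral_nonneg fun ω => by positivity) (hLt k) (by positivity))
        (Real.rpow_nonneg (integral_nonneg fun ω => by positivity) _) (by positivity)
      rw [sub_nonneg, div_le_one hq0]; linarith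
    have hY : ∫ ω, ζ k ω ^ 2 ∂P ≤ s ^ (2 / q) :=
      (integral_sq_le hq (hζ k) (hζq k)).trans
        (Real.rpow_le_rpow (integral_nonneg fun ω => by positivity) (hζs k) (by positivity))
    have hZ : (∫ ω, |L k ω| ^ q ∂P) * ∫ ω, |ζ k ω| ^ q ∂P ≤ a k ^ (q / 2) * t * s :=
      mul_le_mul (hLt k) (hζs k) (integral_nonneg fun ω => by positivity) (by positivity)
    have hXY : (∫ ω, |U k ω| ^ (q - 2) * L k ω ^ 2 ∂P) * (∫ ω, ζ k ω ^ 2 ∂P)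
        ≤ (2 * C * A) ^ (q / 2 - 1) * a k * (t * s) := by
      refine (mul_le_mul hX hY (integral_nonneg fun ω => by positivity) (by positivity)).trans
        (le_of_eq ?_)
      have hB0 : 0 ≤ 2 * C * A := by positivity
      rw [Real.mul_rpow (by positivity) (by positivity),
        Real.mul_rpow (by positivity) ht, ← Real.rpow_mul hB0, ← Real.rpow_mul hak]
      have e1 : q / 2 * (1 - 2 / q) = q / 2 - 1 := by field_simp
      have e2 : q / 2 * (2 / q) = 1 := by field_simp
      -- The exponents of `t` and `s` add up to 1, so the factor `t * s` reproduces itself from step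
      -- to step.
      have e3 : (t * s) ^ (1 - 2 / q) * (t ^ (2 / q) * s ^ (2 / q)) = t * s := by
        rw [← Real.mul_rpow ht hs, ← Real.rpow_add_of_nonneg (by positivity) _ (by positivity)]
        · simp
        · rw [sub_nonneg, div_le_one hq0]; linarith
      rw [e1, e2, Real.rpow_one]
      linear_combination (2 * C * A) ^ (q / 2 - 1) * a k * e3
    have hC0 : 0 ≤ C := by linarith
    calc _ ≤ (2 * C * A) ^ (q / 2) * (t * s) + C * ((2 * C * A) ^ (q / 2 - 1) * a k * (t * s)
          + a k ^ (q / 2) * t * s) := by gcongr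
      _ = ((2 * C * A) ^ (q / 2) + C * ((2 * C * A) ^ (q / 2 - 1) * a k + a k ^ (q / 2)))
          * (t * s) := by ring
      _ ≤ _ := mul_le_mul_of_nonneg_right hkey (by positivity)

end Moments

/-- Constant of the moment inequalities of order `q`. -/
noncomputable def momentConst (q : ℝ) : ℝ := 2 * ((1 + 4 * q) ^ q + 4 * q ^ 2)

theorem momentConst_pos {q : ℝ} (hq : 0 < q) : 0 < momentConst q := by
  unfold momentConst; positivity

/-! ### Excesses of linear and quadratic forms in independent variables. -/

section Forms

variable {Ω : Type*} [MeasurableSpace Ω] {P : Measure Ω}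

theorem indepFun_of_range {ζ : ℕ → Ω → ℝ} (hind : iIndepFun ζ P) (hζ : ∀ k, Measurable (ζ k))
    (k : ℕ) {β : Type*} [MeasurableSpace β] {g : (Finset.range k → ℝ) → β} (hg : Measurable g) :
    IndepFun (fun ω => g fun i => ζ i ω) (ζ k) P := by
  have h := hind.indepFun_finset (Finset.range k) {k} (by simp) hζ
  exact h.comp (φ := g) (ψ := fun v : (({k} : Finset ℕ) → ℝ) => v ⟨k, by simp⟩) hg (by fun_prop)

theorem linear_moment_le [IsProbabilityMeasure P] {q : ℝ} (hq : 2 < q) {ζ : ℕ → Ω → ℝ}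
    (hind : iIndepFun ζ P) (hζ : ∀ k, Measurable (ζ k)) {s : ℝ}
    (hζq : ∀ k, Integrable (fun ω => |ζ k ω| ^ q) P)
    (hζs : ∀ k, ∫ ω, |ζ k ω| ^ q ∂P ≤ s) (hζ0 : ∀ k, ∫ ω, ζ k ω ∂P = 0) (c : ℕ → ℝ) (k : ℕ) :
    Integrable (fun ω => |∑ i ∈ Finset.range k, c i * ζ i ω| ^ q) P ∧
    ∫ ω, |∑ i ∈ Finset.range k, c i * ζ i ω| ^ q ∂P
      ≤ (momentConst q * ∑ i ∈ Finset.range k, c i ^ 2) ^ (q / 2) * s := by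
  have hs : 0 ≤ s := (integral_nonneg fun ω => by positivity).trans (hζs 0)
  have h := moment_recursion (P := P) hq
    (U := fun k ω => ∑ i ∈ Finset.range k, c i * ζ i ω) (L := fun k _ => c k) (ζ := ζ)
    (a := fun k => c k ^ 2) (t := 1) (s := s) (fun k => sq_nonneg _) zero_le_one hs
    (fun k => by fun_prop) (fun k => measurable_const) hζ (by simp)
    (fun k ω => Finset.sum_range_succ _ _)
    (fun k => by
      have := indepFun_of_range hind hζ k
        (g := fun v : Finset.range k → ℝ => (∑ i : Finset.range k, c i * v i, c k)) (by fun_prop)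
      refine this.congr (ae_of_all _ fun ω => ?_) (ae_of_all _ fun ω => rfl)
      simp only
      rw [Finset.sum_coe_sort (Finset.range k) fun i => c i * ζ i ω])
    (fun k => integrable_const _)
    (fun k => by
      simp only [integral_const, probReal_univ, smul_eq_mul, one_mul, mul_one]
      rw [← sq_abs, ← Real.rpow_natCast, ← Real.rpow_mul (abs_nonneg _)]
      apply le_of_eq; congr 1; push_cast; ring)
    hζq hζs hζ0 k
  simpa [momentConst] using h

/-- The strictly triangular form is itself a martingale: its weight at time `k` is a linear form in
the earlier variables. `linear_moment_le` bounds that weight, and this supplies `a` and `t = s` in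
`moment_recursion`; hence the squared constant and `s ^ 2`. -/
theorem chaos_moment_le [IsProbabilityMeasure P] {q : ℝ} (hq : 2 < q) {ζ : ℕ → Ω → ℝ}
    (hind : iIndepFun ζ P) (hζ : ∀ k, Measurable (ζ k)) {s : ℝ}
    (hζq : ∀ k, Integrable (fun ω => |ζ k ω| ^ q) P)
    (hζs : ∀ k, ∫ ω, |ζ k ω| ^ q ∂P ≤ s) (hζ0 : ∀ k, ∫ ω, ζ k ω ∂P = 0) (R : ℕ → ℕ → ℝ) (k : ℕ) :
    Integrable (fun ω => |∑ l ∈ Finset.range k,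
      (∑ i ∈ Finset.range l, R l i * ζ i ω) * ζ l ω| ^ q) P ∧
    ∫ ω, |∑ l ∈ Finset.range k, (∑ i ∈ Finset.range l, R l i * ζ i ω) * ζ l ω| ^ q ∂P
      ≤ (momentConst q ^ 2 * ∑ l ∈ Finset.range k, ∑ i ∈ Finset.range l, R l i ^ 2) ^ (q / 2)
        * s ^ 2 := by
  have hs : 0 ≤ s := (integral_nonneg fun ω => by positivity).trans (hζs 0)
  have hK := momentConst_pos (show 0 < q by linarith)
  have h := moment_recursion (P := P) hq
    (U := fun k ω => ∑ l ∈ Finset.range k, (∑ i ∈ Finset.range l, R l i * ζ i ω) * ζ l ω)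
    (L := fun k ω => ∑ i ∈ Finset.range k, R k i * ζ i ω) (ζ := ζ)
    (a := fun k => momentConst q * ∑ i ∈ Finset.range k, R k i ^ 2) (t := s) (s := s)
    (fun k => mul_nonneg hK.le (Finset.sum_nonneg fun i _ => sq_nonneg _)) hs hs
    (fun k => by fun_prop) (fun k => by fun_prop) hζ (by simp)
    (fun k ω => Finset.sum_range_succ _ _)
    (fun k => by
      have := indepFun_of_range hind hζ k
        (g := fun v : Finset.range k → ℝ =>
          (∑ l : Finset.range k, (∑ i : Finset.range l, R l i *
            v ⟨i, Finset.mem_range.mpr ((Finset.mem_range.mp i.2).trans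
              (Finset.mem_range.mp l.2))⟩) * v l,
            ∑ i : Finset.range k, R k i * v i)) (by fun_prop)
      refine this.congr (ae_of_all _ fun ω => ?_) (ae_of_all _ fun ω => rfl)
      simp only
      rw [Finset.sum_coe_sort (Finset.range k) fun i => R k i * ζ i ω,
        ← Finset.sum_coe_sort (Finset.range k)
          fun l => (∑ i ∈ Finset.range l, R l i * ζ i ω) * ζ l ω]
      congr 1
      refine Finset.sum_congr rfl fun l _ => ?_
      rw [Finset.sum_coe_sort (Finset.range l) fun i => R l i * ζ i ω])
    (fun k => (linear_moment_le hq hind hζ hζq hζs hζ0 (R k) k).1)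
    (fun k => (linear_moment_le hq hind hζ hζq hζs hζ0 (R k) k).2)
    hζq hζs hζ0 k
  refine ⟨h.1, h.2.trans (le_of_eq ?_)⟩
  rw [← Finset.mul_sum, ← sq s, ← mul_assoc, sq (momentConst q)]
  rfl

/-- If x > t then 1 ≤ (x/t)^(q−1). This turns a moment bound into a bound on the expected excess
over the level `t`. -/
theorem sub_le_rpow_div {q x t : ℝ} (hq : 1 ≤ q) (ht : 0 < t) : x - t ≤ |x| ^ q / t ^ (q - 1) := by
  rcases le_or_gt x t with h | h
  · exact (sub_nonpos.mpr h).trans (by positivity)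
  · have hx : 0 < x := ht.trans h
    rw [abs_of_pos hx, le_div_iff₀ (by positivity)]
    have h1 : t ^ (q - 1) ≤ x ^ (q - 1) := Real.rpow_le_rpow ht.le h.le (by linarith)
    have h2 : x ^ q = x * x ^ (q - 1) := by
      rw [mul_comm, ← Real.rpow_add_one hx.ne']; congr 1; ring
    rw [h2]
    exact mul_le_mul (by linarith) h1 (by positivity) hx.le

theorem lintegral_ofReal_le_of_le {f g : Ω → ℝ} {b : ℝ} (hfg : ∀ ω, f ω ≤ g ω)
    (hg : Integrable g P) (hg0 : ∀ ω, 0 ≤ g ω) (hb : ∫ ω, g ω ∂P ≤ b) :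
    ∫⁻ ω, ENNReal.ofReal (f ω) ∂P ≤ ENNReal.ofReal b := by
  calc ∫⁻ ω, ENNReal.ofReal (f ω) ∂P ≤ ∫⁻ ω, ENNReal.ofReal (g ω) ∂P :=
        lintegral_mono fun ω => ENNReal.ofReal_le_ofReal (hfg ω)
    _ = ENNReal.ofReal (∫ ω, g ω ∂P) :=
        (ofReal_integral_eq_lintegral_ofReal hg (ae_of_all _ hg0)).symm
    _ ≤ _ := ENNReal.ofReal_le_ofReal hb

theorem linear_form_tail [IsProbabilityMeasure P] {p κ : ℝ} (hp : 4 < p) (hκ : 0 < κ)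
    {ε : ℕ → Ω → ℝ} (hind : iIndepFun ε P) (hε : ∀ k, Measurable (ε k)) {τ σ : ℝ} (hσ : 0 < σ)
    (hεp : ∀ k, Integrable (fun ω => |ε k ω| ^ p) P)
    (hετ : ∀ k, ∫ ω, |ε k ω| ^ p ∂P ≤ τ) (hε0 : ∀ k, ∫ ω, ε k ω ∂P = 0)
    (n : ℕ) (c : ℕ → ℝ) (hc : ∑ i ∈ Finset.range n, c i ^ 2 ≤ 1) {M : ℝ} (hM : 0 < M) :
    ∫⁻ ω, ENNReal.ofReal ((∑ i ∈ Finset.range n, c i * ε i ω) ^ 2 - κ * σ ^ 2 * M) ∂P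
      ≤ ENNReal.ofReal (momentConst p ^ (p / 2) / κ ^ (p / 2 - 1) * M ^ (1 - p / 2)
        * (τ / σ ^ p * σ ^ 2)) := by
  have hτ : 0 ≤ τ := (integral_nonneg fun ω => by positivity).trans (hετ 0)
  have hK := momentConst_pos (show 0 < p by linarith)
  obtain ⟨h1, h2⟩ := linear_moment_le (by linarith) hind hε hεp hετ hε0 c n
  have ht : 0 < κ * σ ^ 2 * M := by positivity
  refine lintegral_ofReal_le_of_le
    (g := fun ω => |∑ i ∈ Finset.range n, c i * ε i ω| ^ p / (κ * σ ^ 2 * M) ^ (p / 2 - 1))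
    (fun ω => ?_) (h1.div_const _) (fun ω => by positivity) ?_
  · refine (sub_le_rpow_div (q := p / 2) (by linarith) ht).trans (le_of_eq ?_)
    congr 1
    rw [abs_of_nonneg (sq_nonneg _), ← sq_abs, ← Real.rpow_natCast,
      ← Real.rpow_mul (abs_nonneg _)]
    congr 1; push_cast; ring
  · rw [integral_div]
    have hS : (momentConst p * ∑ i ∈ Finset.range n, c i ^ 2) ^ (p / 2)
        ≤ momentConst p ^ (p / 2) := by
      refine Real.rpow_le_rpow (mul_nonneg hK.le (Finset.sum_nonneg fun i _ => sq_nonneg _)) ?_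
        (by linarith)
      nlinarith
    have e1 : (κ * σ ^ 2 * M) ^ (p / 2 - 1)
        = κ ^ (p / 2 - 1) * (σ ^ p / σ ^ 2) * (M ^ (1 - p / 2))⁻¹ := by
      rw [Real.mul_rpow (by positivity) hM.le, Real.mul_rpow hκ.le (by positivity),
        ← Real.rpow_natCast σ 2, ← Real.rpow_mul hσ.le, ← Real.rpow_sub hσ, ← Real.rpow_neg hM.le]
      congr 2
      · congr 1; push_cast; ring
      · ring
    calc _ ≤ momentConst p ^ (p / 2) * τ / (κ * σ ^ 2 * M) ^ (p / 2 - 1) := by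
          gcongr
          exact h2.trans (mul_le_mul_of_nonneg_right hS hτ)
      _ = _ := by rw [e1]; field_simp

/-- Separates the diagonal, a linear form in the squares, from an off-diagonal part already in the
predictable shape of `chaos_moment_le`. -/
theorem sum_quadratic_eq (Q : ℕ → ℕ → ℝ) (hQ : ∀ i k, Q i k = Q k i) (e : ℕ → ℝ) (n : ℕ) :
    ∑ i ∈ Finset.range n, ∑ k ∈ Finset.range n, Q i k * e i * e k
      = ∑ i ∈ Finset.range n, Q i i * e i ^ 2
        + 2 * ∑ l ∈ Finset.range n, (∑ i ∈ Finset.range l, Q l i * e i) * e l := by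
  induction n with
  | zero => simp
  | succ n ih =>
    rw [Finset.sum_range_succ, Finset.sum_range_succ _ n, Finset.sum_range_succ _ n,
      Finset.sum_range_succ _ n]
    simp only [Finset.sum_range_succ _ n]
    rw [Finset.sum_add_distrib, ih]
    have h1 : ∑ x ∈ Finset.range n, Q x n * e x * e n
        = (∑ i ∈ Finset.range n, Q n i * e i) * e n := by
      rw [Finset.sum_mul]; exact Finset.sum_congr rfl fun i _ => by rw [hQ i n]
    have h2 : ∑ x ∈ Finset.range n, Q n x * e n * e x
        = (∑ i ∈ Finset.range n, Q n i * e i) * e n := by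
      rw [Finset.sum_mul]; exact Finset.sum_congr rfl fun i _ => by ring
    rw [h1, h2]; ring

theorem abs_add_rpow_le_two_rpow {q : ℝ} (hq : 0 < q) (a b : ℝ) :
    |a + b| ^ q ≤ 2 ^ q * (|a| ^ q + |b| ^ q) := by
  have h1 : |a + b| ≤ 2 * max |a| |b| := by
    have := abs_add_le a b
    have := le_max_left |a| |b|
    have := le_max_right |a| |b|
    linarith
  have h2 : max |a| |b| ^ q ≤ |a| ^ q + |b| ^ q := by
    have ha : 0 ≤ |a| ^ q := by positivity
    have hb : 0 ≤ |b| ^ q := by positivity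
    rcases max_choice |a| |b| with h | h <;> rw [h] <;> linarith
  calc |a + b| ^ q ≤ (2 * max |a| |b|) ^ q := Real.rpow_le_rpow (abs_nonneg _) h1 hq.le
    _ = 2 ^ q * max |a| |b| ^ q := Real.mul_rpow (by norm_num) (by positivity)
    _ ≤ _ := by gcongr

/-- Upper deviations of the quadratic form of a matrix `Q` dominated by a projector of trace at
most `M`. -/
theorem quadratic_form_tail [IsProbabilityMeasure P] {p δ : ℝ} (hp : 4 < p) (hδ : 0 < δ)
    {ε : ℕ → Ω → ℝ} (hind : iIndepFun ε P) (hε : ∀ k, Measurable (ε k)) {τ σ : ℝ} (hσ : 0 < σ)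
    (hεp : ∀ k, Integrable (fun ω => |ε k ω| ^ p) P)
    (hετ : ∀ k, ∫ ω, |ε k ω| ^ p ∂P ≤ τ) (hε0 : ∀ k, ∫ ω, ε k ω ∂P = 0)
    (hε2 : ∀ k, ∫ ω, ε k ω ^ 2 ∂P = σ ^ 2)
    (n : ℕ) (Q : ℕ → ℕ → ℝ) (hQ : ∀ i k, Q i k = Q k i)
    (hQ2 : ∀ i < n, ∑ k ∈ Finset.range n, Q i k ^ 2 ≤ Q i i) {M : ℝ} (hM : 0 < M)
    (hQM : ∑ i ∈ Finset.range n, Q i i ≤ M) :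
    ∫⁻ ω, ENNReal.ofReal (∑ i ∈ Finset.range n, ∑ k ∈ Finset.range n, Q i k * ε i ω * ε k ω
        - (1 + δ) * σ ^ 2 * M) ∂P
      ≤ ENNReal.ofReal (2 ^ (p / 2) * (2 * momentConst (p / 2) ^ (p / 4)
          + 2 ^ (p / 2) * (momentConst (p / 2) ^ 2) ^ (p / 4)) / δ ^ (p / 2 - 1) * M ^ (1 - p / 4)
        * (τ / σ ^ p * σ ^ 2)) := by
  have hτ : 0 ≤ τ := (integral_nonneg fun ω => by positivity).trans (hετ 0)
  set q := p / 2 with hqp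
  have hq : 2 < q := by linarith
  have hp2 : p = 2 * q := by linarith
  have hp4 : p / 4 = q / 2 := by linarith
  set K := momentConst q with hKdef
  have hK : 0 < K := momentConst_pos (by linarith)
  -- Lets the moments of the centred squares be bounded by `2 * τ` alone.
  have hσp : σ ^ p ≤ τ := by
    have h := integral_sq_le (P := P) (q := p) (by linarith) (hε 0) (hεp 0)
    rw [hε2 0] at h
    have h2 := Real.rpow_le_rpow (by positivity) (h.trans (Real.rpow_le_rpow
      (integral_nonneg fun ω => by positivity) (hετ 0) (by positivity)))
      (show 0 ≤ p / 2 by linarith)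
    rw [← Real.rpow_mul hτ, ← Real.rpow_natCast σ 2, ← Real.rpow_mul hσ.le] at h2
    have e1 : 2 / p * (p / 2) = 1 := by field_simp
    have e2 : ((2 : ℕ) : ℝ) * (p / 2) = p := by push_cast; ring
    rwa [e1, e2, Real.rpow_one] at h2
  have hpq : ∀ x : ℝ, |x| ^ p = (x ^ 2) ^ q := fun x => by
    rw [← sq_abs, ← Real.rpow_natCast, ← Real.rpow_mul (abs_nonneg _)]
    congr 1
  -- diagonal part
  have hηpt : ∀ k ω, |ε k ω ^ 2 - σ ^ 2| ^ q ≤ |ε k ω| ^ p + σ ^ p := fun k ω => by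
    have e1 : σ ^ p = (σ ^ 2) ^ q := by rw [← hpq, abs_of_pos hσ]
    rw [hpq, e1]
    have h1 : |ε k ω ^ 2 - σ ^ 2| ≤ max (ε k ω ^ 2) (σ ^ 2) := by
      have h2 := le_max_left (ε k ω ^ 2) (σ ^ 2)
      have h3 := le_max_right (ε k ω ^ 2) (σ ^ 2)
      rw [abs_le]; constructor <;> nlinarith [sq_nonneg (ε k ω), sq_nonneg σ]
    refine (Real.rpow_le_rpow (abs_nonneg _) h1 (by linarith)).trans ?_
    have ha : 0 ≤ (ε k ω ^ 2) ^ q := by positivity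
    have hb : 0 ≤ (σ ^ 2) ^ q := by positivity
    rcases max_choice (ε k ω ^ 2) (σ ^ 2) with h | h <;> rw [h] <;> linarith
  have hηI : ∀ k, Integrable (fun ω => |ε k ω ^ 2 - σ ^ 2| ^ q) P := fun k => by
    refine ((hεp k).add (integrable_const (σ ^ p))).mono'
      (Measurable.aestronglyMeasurable (by fun_prop)) (ae_of_all _ fun ω => ?_)
    rw [Real.norm_of_nonneg (by positivity)]
    exact hηpt k ω
  have hηs : ∀ k, ∫ ω, |ε k ω ^ 2 - σ ^ 2| ^ q ∂P ≤ 2 * τ := fun k => by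
    have h := integral_mono (hηI k) ((hεp k).add (integrable_const (σ ^ p))) (hηpt k)
    have h2 := integral_add (hεp k) (integrable_const (μ := P) (σ ^ p))
    simp only [Pi.add_apply] at h
    rw [h2] at h
    simp only [integral_const, probReal_univ, smul_eq_mul, one_mul] at h
    linarith [hετ k]
  have hε2I : ∀ k, Integrable (fun ω => ε k ω ^ 2) P := fun k => by
    have := integrable_rpow_mul (P := P) (q := p) (s := 2) (by norm_num) (by linarith)
      (U := fun _ => 1) measurable_const (hε k) (by simp) (hεp k)
    simpa using this
  have hη0 : ∀ k, ∫ ω, (ε k ω ^ 2 - σ ^ 2) ∂P = 0 := fun k => by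
    rw [integral_sub (hε2I k) (integrable_const _), hε2]; simp
  have hηind : iIndepFun (fun k ω => ε k ω ^ 2 - σ ^ 2) P :=
    hind.comp (fun _ x => x ^ 2 - σ ^ 2) (fun _ => by fun_prop)
  obtain ⟨hDI, hD⟩ := linear_moment_le hq hηind (fun k => by fun_prop) hηI hηs hη0
    (fun i => Q i i) n
  -- off-diagonal part
  have hεqI : ∀ k, Integrable (fun ω => |ε k ω| ^ q) P := fun k => by
    have := integrable_rpow_mul (P := P) (q := p) (s := q) (by linarith) (by linarith)
      (U := fun _ => 1) measurable_const (hε k) (by simp) (hεp k)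
    simpa using this
  -- Cauchy–Schwarz, in the form of a nonnegative variance. The chaos bound squares this moment, so
  -- only `τ` remains.
  have hεq : ∀ k, ∫ ω, |ε k ω| ^ q ∂P ≤ √τ := fun k => by
    refine Real.le_sqrt_of_sq_le ?_
    set m := ∫ ω, |ε k ω| ^ q ∂P with hm
    have e1 : ∀ ω, (|ε k ω| ^ q) ^ 2 = |ε k ω| ^ p := fun ω => by
      rw [← Real.rpow_natCast, ← Real.rpow_mul (abs_nonneg _)]
      congr 1; push_cast; linarith
    have h0 : 0 ≤ ∫ ω, (|ε k ω| ^ q - m) ^ 2 ∂P := integral_nonneg fun ω => sq_nonneg _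
    have h1 : ∫ ω, (|ε k ω| ^ q - m) ^ 2 ∂P = ∫ ω, |ε k ω| ^ p ∂P - m ^ 2 := by
      have : ∀ ω, (|ε k ω| ^ q - m) ^ 2 = |ε k ω| ^ p - 2 * m * |ε k ω| ^ q + m ^ 2 := fun ω => by
        rw [← e1]; ring
      simp only [this]
      have hi : Integrable (fun ω => |ε k ω| ^ p - 2 * m * |ε k ω| ^ q) P :=
        (hεp k).sub ((hεqI k).const_mul _)
      rw [integral_add hi (integrable_const _), integral_sub (hεp k) ((hεqI k).const_mul _), integral_const_mul, ← hm]
      simp; ring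
    linarith [hετ k]
  obtain ⟨hOI, hO⟩ := chaos_moment_le hq hind hε hεqI hεq hε0 Q n
  rw [Real.sq_sqrt hτ] at hO
  -- bounds on the weights
  have hQd : ∀ i ∈ Finset.range n, Q i i ^ 2 ≤ Q i i := fun i hi =>
    (Finset.single_le_sum (f := fun k => Q i k ^ 2) (fun k _ => sq_nonneg _) hi).trans
      (hQ2 i (Finset.mem_range.mp hi))
  have hA1 : ∑ i ∈ Finset.range n, Q i i ^ 2 ≤ M := (Finset.sum_le_sum hQd).trans hQM
  have hA2 : ∑ l ∈ Finset.range n, ∑ i ∈ Finset.range l, Q l i ^ 2 ≤ M := by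
    refine (Finset.sum_le_sum fun l hl => ?_).trans hQM
    refine (Finset.sum_le_sum_of_subset_of_nonneg ?_ fun i _ _ => sq_nonneg _).trans
      (hQ2 l (Finset.mem_range.mp hl))
    exact Finset.range_mono (Finset.mem_range.mp hl).le
  have hD' := hD.trans (mul_le_mul_of_nonneg_right (Real.rpow_le_rpow
    (mul_nonneg hK.le (Finset.sum_nonneg fun i _ => sq_nonneg _))
    (mul_le_mul_of_nonneg_left hA1 hK.le) (by linarith)) (by positivity))
  have hO' := hO.trans (mul_le_mul_of_nonneg_right (Real.rpow_le_rpow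
    (mul_nonneg (by positivity) (Finset.sum_nonneg fun i _ => Finset.sum_nonneg
      fun i _ => sq_nonneg _))
    (mul_le_mul_of_nonneg_left hA2 (by positivity)) (by linarith)) (by positivity))
  rw [← hKdef, Real.mul_rpow hK.le hM.le] at hD'
  rw [← hKdef, Real.mul_rpow (by positivity) hM.le] at hO'
  set D : Ω → ℝ := fun ω => ∑ i ∈ Finset.range n, Q i i * (ε i ω ^ 2 - σ ^ 2) with hDdef
  set O : Ω → ℝ := fun ω => ∑ l ∈ Finset.range n,
    (∑ i ∈ Finset.range l, Q l i * ε i ω) * ε l ω with hOdef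
  have ht : 0 < δ * σ ^ 2 * M := by positivity
  have hIR := (hDI.add (hOI.const_mul (2 ^ q))).const_mul (2 ^ q)
  refine lintegral_ofReal_le_of_le
    (g := fun ω => 2 ^ q * (|D ω| ^ q + 2 ^ q * |O ω| ^ q) / (δ * σ ^ 2 * M) ^ (q - 1))
    (fun ω => ?_) (hIR.div_const _) (fun ω => by positivity) ?_
  · rw [sum_quadratic_eq Q hQ]
    have h1 : ∑ i ∈ Finset.range n, Q i i * ε i ω ^ 2
        = D ω + σ ^ 2 * ∑ i ∈ Finset.range n, Q i i := by
      rw [hDdef, Finset.mul_sum, ← Finset.sum_add_distrib]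
      exact Finset.sum_congr rfl fun i _ => by ring
    have h2 : σ ^ 2 * ∑ i ∈ Finset.range n, Q i i ≤ σ ^ 2 * M := by gcongr
    -- The mean σ² tr Q uses up the 1 in 1 + δ; the fluctuations are compared with the remaining
    -- δσ²M.
    calc _ ≤ (D ω + 2 * O ω) - δ * σ ^ 2 * M := by rw [h1]; linarith
      _ ≤ |D ω + 2 * O ω| ^ q / (δ * σ ^ 2 * M) ^ (q - 1) := sub_le_rpow_div (by linarith) ht
      _ ≤ _ := by
        refine div_le_div_of_nonneg_right ?_ (by positivity)
        refine (abs_add_rpow_le_two_rpow (by linarith) _ _).trans (le_of_eq ?_)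
        rw [abs_mul, Real.mul_rpow (abs_nonneg _) (abs_nonneg _), abs_two]
  · rw [integral_div, integral_const_mul, integral_add hDI (hOI.const_mul _), integral_const_mul]
    have e1 : (δ * σ ^ 2 * M) ^ (q - 1)
        = δ ^ (q - 1) * (σ ^ p / σ ^ 2) * (M ^ (q / 2) * (M ^ (1 - q / 2))⁻¹) := by
      rw [Real.mul_rpow (by positivity) hM.le, Real.mul_rpow hδ.le (by positivity),
        ← Real.rpow_natCast σ 2, ← Real.rpow_mul hσ.le, ← Real.rpow_sub hσ, ← Real.rpow_neg hM.le,
        ← Real.rpow_add hM]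
      congr 2
      · congr 1; push_cast; linarith
      · ring
    rw [hp4]
    calc _ ≤ 2 ^ q * (K ^ (q / 2) * M ^ (q / 2) * (2 * τ)
            + 2 ^ q * ((K ^ 2) ^ (q / 2) * M ^ (q / 2) * τ)) / (δ * σ ^ 2 * M) ^ (q - 1) := by
          gcongr
      _ = _ := by rw [e1]; field_simp

end Forms

/-! ### Deterministic analysis for a fixed design. -/

section Design

variable {H : Type*} [NormedAddCommGroup H] [InnerProductSpace ℝ H] {n : ℕ}

/-- The empirical bilinear form `⟨Γ_n f, g⟩`. -/
noncomputable def empForm (x : Fin n → H) (f g : H) : ℝ :=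
  (1 / (n : ℝ)) * ∑ i, ⟪f, x i⟫ * ⟪g, x i⟫

/-- The empirical noise functional `t ↦ n⁻¹ ∑ eᵢ ⟨t, xᵢ⟩`. -/
noncomputable def noiseFun (x : Fin n → H) (e : Fin n → ℝ) (t : H) : ℝ :=
  (1 / (n : ℝ)) * ∑ i, e i * ⟪t, x i⟫

/-- Squared empirical norm of the projection of the noise on the first `m` eigenvectors. -/
noncomputable def noiseSq (x : Fin n → H) (e : Fin n → ℝ) (lam : ℕ → ℝ) (ψ : ℕ → H) (m : ℕ) : ℝ :=
  ∑ j ∈ Finset.range m, noiseFun x e (ψ j) ^ 2 / lam j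

/-- Remainder of the expansion of `β` along the first `m` vectors of `ψ`. -/
noncomputable def resid (β : H) (ψ : ℕ → H) (m : ℕ) : H :=
  β - ∑ j ∈ Finset.range m, ⟪β, ψ j⟫ • ψ j

/-- Square of the noise in the normalized direction of `resid β ψ m`. -/
noncomputable def residNoise (x : Fin n → H) (e : Fin n → ℝ) (β : H) (ψ : ℕ → H) (m : ℕ) : ℝ :=
  noiseFun x e (resid β ψ m) ^ 2 / empNormSq x (resid β ψ m)

theorem empForm_comm (x : Fin n → H) (f g : H) : empForm x f g = empForm x g f := by
  simp only [empForm, mul_comm]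

theorem empForm_self (x : Fin n → H) (f : H) : empForm x f f = empNormSq x f := by
  simp only [empForm, empNormSq, sq]

theorem empForm_add_left (x : Fin n → H) (f g h : H) :
    empForm x (f + g) h = empForm x f h + empForm x g h := by
  simp only [empForm, inner_add_left, add_mul, Finset.sum_add_distrib, mul_add]

theorem empForm_smul_left (x : Fin n → H) (c : ℝ) (f h : H) :
    empForm x (c • f) h = c * empForm x f h := by
  simp only [empForm, inner_smul_left, RCLike.conj_to_real, mul_assoc]
  rw [← Finset.mul_sum]; ring

theorem empForm_sum_left (x : Fin n → H) (s : Finset ℕ) (f : ℕ → H) (h : H) :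
    empForm x (∑ j ∈ s, f j) h = ∑ j ∈ s, empForm x (f j) h := by
  induction s using Finset.induction_on with
  | empty => simp [empForm]
  | insert a s ha ih => rw [Finset.sum_insert ha, Finset.sum_insert ha, empForm_add_left, ih]

theorem empNormSq_nonneg (x : Fin n → H) (f : H) : 0 ≤ empNormSq x f :=
  mul_nonneg (by positivity) (Finset.sum_nonneg fun i _ => sq_nonneg _)

theorem empNormSq_add (x : Fin n → H) (f g : H) :
    empNormSq x (f + g) = empNormSq x f + 2 * empForm x f g + empNormSq x g := by
  rw [← empForm_self, empForm_add_left, empForm_comm x f, empForm_comm x g, empForm_add_left,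
    empForm_add_left, empForm_self, empForm_self, empForm_comm x g f]
  ring

theorem empNormSq_neg (x : Fin n → H) (f : H) : empNormSq x (-f) = empNormSq x f := by
  simp [empNormSq]

theorem empNormSq_sub_comm (x : Fin n → H) (f g : H) :
    empNormSq x (f - g) = empNormSq x (g - f) := by
  rw [← empNormSq_neg, neg_sub]

theorem inner_empCov (x : Fin n → H) (f g : H) : ⟪empCov x f, g⟫ = empForm x f g := by
  simp only [empCov, empForm, inner_smul_left, sum_inner, RCLike.conj_to_real]
  congr 1
  exact Finset.sum_congr rfl fun i _ => by rw [real_inner_comm g]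

theorem noiseFun_add (x : Fin n → H) (e : Fin n → ℝ) (f g : H) :
    noiseFun x e (f + g) = noiseFun x e f + noiseFun x e g := by
  simp only [noiseFun, inner_add_left, mul_add, Finset.sum_add_distrib]

theorem noiseFun_smul (x : Fin n → H) (e : Fin n → ℝ) (c : ℝ) (f : H) :
    noiseFun x e (c • f) = c * noiseFun x e f := by
  simp only [noiseFun, inner_smul_left, RCLike.conj_to_real, mul_left_comm _ c]
  rw [← Finset.mul_sum]; ring

theorem noiseFun_sum (x : Fin n → H) (e : Fin n → ℝ) (s : Finset ℕ) (f : ℕ → H) :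
    noiseFun x e (∑ j ∈ s, f j) = ∑ j ∈ s, noiseFun x e (f j) := by
  induction s using Finset.induction_on with
  | empty => simp [noiseFun]
  | insert a s ha ih => rw [Finset.sum_insert ha, Finset.sum_insert ha, noiseFun_add, ih]

theorem noiseFun_eq_zero (x : Fin n → H) (e : Fin n → ℝ) {f : H} (hn : 0 < n)
    (hf : empNormSq x f = 0) : noiseFun x e f = 0 := by
  have hn' : (0 : ℝ) < n := by exact_mod_cast hn
  have h1 : ∑ i, ⟪f, x i⟫ ^ 2 = 0 := by
    rcases mul_eq_zero.mp hf with h | h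
    · have : (0 : ℝ) < 1 / n := by positivity
      linarith
    · exact h
  have h2 := (Finset.sum_eq_zero_iff_of_nonneg fun i _ => sq_nonneg ⟪f, x i⟫).mp h1
  rw [noiseFun, Finset.sum_eq_zero fun i hi => by rw [pow_eq_zero_iff two_ne_zero |>.mp (h2 i hi),
    mul_zero], mul_zero]

/-- Weighted AM–GM, with weight 1/2 so that half of the bias survives on the left of the criterion
comparison. When the empirical norm is zero the noise functional vanishes too, and 0/0 = 0 is
harmless. -/
theorem two_mul_abs_noiseFun_le (x : Fin n → H) (e : Fin n → ℝ) (f : H) (hn : 0 < n) :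
    2 * |noiseFun x e f| ≤ empNormSq x f / 2 + 2 * (noiseFun x e f ^ 2 / empNormSq x f) := by
  rcases (empNormSq_nonneg x f).eq_or_lt with h | h
  · rw [noiseFun_eq_zero x e hn h.symm, ← h]; simp
  · rw [← sq_abs (noiseFun x e f)]
    set a := |noiseFun x e f|
    set b := empNormSq x f
    have : b / 2 + 2 * (a ^ 2 / b) - 2 * a = (b - 2 * a) ^ 2 / (2 * b) := by field_simp; ring
    have : 0 ≤ (b - 2 * a) ^ 2 / (2 * b) := by positivity
    linarith

/-- Budget of the surplus θ in the penalty: θ/2 is spent on `V` and 2 · θ/16 on the cross term. The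
remaining 3θ/8 bounds `am`, and hence `V`, which is the source of the factor 1 + 1/θ. -/
theorem loss_le_aux {θ am ak B B' V R₁ R₂ R₃ : ℝ} (hθ : 0 < θ) (hm : 0 ≤ am) (hk : 0 ≤ ak)
    (hB : 0 ≤ B) (hB' : 0 ≤ B') (hR₁ : 0 ≤ R₁) (hR₂ : 0 ≤ R₂) (hR₃ : 0 ≤ R₃)
    (h₁ : V ≤ (1 + θ / 2) * am + R₁)
    (h : B / 2 + (1 + θ) * am ≤ V + 2 * (θ / 16 * am + R₂) + 3 / 2 * B'
      + 2 * (θ / 16 * ak + R₃) + (1 + θ) * ak) :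
    B + V ≤ 6 * ((1 + 1 / θ) * (2 * (B' + (1 + θ) * ak + (R₁ + R₂ + R₃)))) := by
  have hθk : 0 ≤ θ * ak := by positivity
  have hθm : 0 ≤ θ * am := by positivity
  obtain ⟨R, hR⟩ : ∃ R, R = B' + (1 + θ) * ak + (R₁ + R₂ + R₃) := ⟨_, rfl⟩
  have hmain : B / 2 + 3 / 8 * (θ * am) ≤ 2 * R := by linarith
  have hR0 : R₁ ≤ R := by linarith
  have hRn : 0 ≤ R := hR₁.trans hR0
  have hθam : am ≤ 6 * R / θ := by
    rw [le_div_iff₀ hθ]; linarith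
  have e3 : 6 * ((1 + 1 / θ) * (2 * R)) = 12 * R + 2 * (6 * R / θ) := by field_simp; ring
  have e4 : 0 ≤ 6 * R / θ := by positivity
  rw [← hR, e3]
  linarith

section Eigen

variable {x : Fin n → H} {lam : ℕ → ℝ} {ψ : ℕ → H}

theorem IsEigensystem.empForm_eigen (h : IsEigensystem (empCov x) lam ψ) (j : ℕ) (f : H) :
    empForm x (ψ j) f = lam j * ⟪ψ j, f⟫ := by
  rw [← inner_empCov, h.eigen, inner_smul_left]; rfl

theorem IsEigensystem.inner_eq (h : IsEigensystem (empCov x) lam ψ) (i j : ℕ) :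
    ⟪ψ i, ψ j⟫ = if i = j then 1 else 0 := orthonormal_iff_ite.mp h.orthonormal i j

theorem IsEigensystem.lam_eq (h : IsEigensystem (empCov x) lam ψ) (j : ℕ) :
    lam j = empNormSq x (ψ j) := by
  rw [← empForm_self, h.empForm_eigen, h.inner_eq, if_pos rfl, mul_one]

theorem IsEigensystem.lam_nonneg (h : IsEigensystem (empCov x) lam ψ) (j : ℕ) : 0 ≤ lam j := by
  rw [h.lam_eq]; exact empNormSq_nonneg _ _

theorem IsEigensystem.inner_resid (h : IsEigensystem (empCov x) lam ψ) (β : H) {j m : ℕ}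
    (hj : j < m) : ⟪ψ j, resid β ψ m⟫ = 0 := by
  simp only [resid, inner_sub_right, inner_sum, inner_smul_right, h.inner_eq, mul_ite, mul_one,
    mul_zero]
  rw [Finset.sum_ite_eq, if_pos (Finset.mem_range.mpr hj), real_inner_comm, sub_self]

/-- Pythagoras in the empirical semi-norm: Γ_n ψ_j is a multiple of ψ_j, so Hilbert orthogonality of
the residual to ψ_j is also empirical orthogonality. -/
theorem IsEigensystem.empNormSq_resid_sub (h : IsEigensystem (empCov x) lam ψ) (β : H) (m : ℕ)
    (d : ℕ → ℝ) :
    empNormSq x (resid β ψ m - ∑ j ∈ Finset.range m, d j • ψ j)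
      = empNormSq x (resid β ψ m) + ∑ j ∈ Finset.range m, lam j * d j ^ 2 := by
  have h1 : empForm x (∑ j ∈ Finset.range m, d j • ψ j) (resid β ψ m) = 0 := by
    rw [empForm_sum_left]
    refine Finset.sum_eq_zero fun j hj => ?_
    rw [empForm_smul_left, h.empForm_eigen, h.inner_resid β (Finset.mem_range.mp hj)]
    simp
  have h2 : empNormSq x (∑ j ∈ Finset.range m, d j • ψ j)
      = ∑ j ∈ Finset.range m, lam j * d j ^ 2 := by
    rw [← empForm_self, empForm_sum_left]
    refine Finset.sum_congr rfl fun j hj => ?_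
    rw [empForm_smul_left, h.empForm_eigen]
    simp only [inner_sum, inner_smul_right, h.inner_eq, mul_ite, mul_one, mul_zero]
    rw [Finset.sum_ite_eq, if_pos hj]; ring
  have h3 : empForm x (resid β ψ m) (-∑ j ∈ Finset.range m, d j • ψ j) = 0 := by
    rw [empForm_comm, ← neg_one_smul ℝ, empForm_smul_left, h1, mul_zero]
  rw [sub_eq_add_neg, empNormSq_add, empNormSq_neg, h2, h3]; ring

theorem IsEigensystem.proj_apply (h : IsEigensystem (empCov x) lam ψ) (β : H) (m : ℕ) :
    proj ψ m β = ∑ j ∈ Finset.range m, ⟪β, ψ j⟫ • ψ j := by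
  refine Submodule.eq_starProjection_of_mem_of_inner_eq_zero ?_ fun w hw => ?_
  · refine Submodule.sum_mem _ fun j hj => Submodule.smul_mem _ _ (Submodule.subset_span ?_)
    exact ⟨⟨j, Finset.mem_range.mp hj⟩, rfl⟩
  · refine Submodule.span_induction (p := fun w _ => ⟪resid β ψ m, w⟫ = 0) ?_ (by simp) ?_ ?_ hw
    · rintro _ ⟨j, rfl⟩
      rw [real_inner_comm]; exact h.inner_resid β j.2
    · intro a b _ _ ha hb; rw [inner_add_right, ha, hb, add_zero]
    · intro c a _ ha; rw [inner_smul_right, ha, mul_zero]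

/-- The two residuals differ by components along ψ_N, …, ψ_{m−1}, each weighted by an eigenvalue at
most `s`; Bessel bounds their sum. -/
theorem IsEigensystem.empNormSq_resid_le (h : IsEigensystem (empCov x) lam ψ) (β : H) {N m : ℕ}
    (hNm : N ≤ m) {s : ℝ} (hs : 0 ≤ s) (hlam : ∀ j, N ≤ j → j < m → lam j ≤ s) :
    empNormSq x (resid β ψ N) ≤ empNormSq x (resid β ψ m) + s * ‖β‖ ^ 2 := by
  have e1 : resid β ψ N = resid β ψ m
      - ∑ j ∈ Finset.range m, (if j < N then 0 else -⟪β, ψ j⟫) • ψ j := by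
    have h1 : ∑ j ∈ Finset.range N, ⟪β, ψ j⟫ • ψ j
        = ∑ j ∈ Finset.range m, (if j < N then ⟪β, ψ j⟫ else 0) • ψ j := by
      rw [← Finset.sum_subset (Finset.range_mono hNm)]
      · exact Finset.sum_congr rfl fun j hj => by rw [if_pos (Finset.mem_range.mp hj)]
      · intro j _ hj
        rw [if_neg (by simpa using hj), zero_smul]
    rw [resid, resid, h1, sub_sub, ← Finset.sum_add_distrib]
    congr 1
    refine Finset.sum_congr rfl fun j _ => ?_
    split_ifs <;> simp
  rw [e1, h.empNormSq_resid_sub]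
  gcongr
  calc _ ≤ ∑ j ∈ Finset.range m, s * ‖⟪ψ j, β⟫‖ ^ 2 := by
        refine Finset.sum_le_sum fun j hj => ?_
        split_ifs with hj'
        · rw [zero_pow two_ne_zero, mul_zero]; positivity
        · rw [neg_sq, real_inner_comm, Real.norm_eq_abs, sq_abs]
          exact mul_le_mul_of_nonneg_right
            (hlam j (not_lt.mp hj') (Finset.mem_range.mp hj)) (sq_nonneg _)
    _ ≤ _ := by
        rw [← Finset.mul_sum]
        exact mul_le_mul_of_nonneg_left (h.orthonormal.sum_inner_products_le β) hs

theorem IsEigensystem.noiseSq_mono (h : IsEigensystem (empCov x) lam ψ) (e : Fin n → ℝ) :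
    Monotone (noiseSq x e lam ψ) := fun _ _ hab =>
  Finset.sum_le_sum_of_subset_of_nonneg (Finset.range_mono hab) fun j _ _ =>
    div_nonneg (sq_nonneg _) (h.lam_nonneg j)

theorem IsEigensystem.noiseSq_nonneg (h : IsEigensystem (empCov x) lam ψ) (e : Fin n → ℝ) (m : ℕ) :
    0 ≤ noiseSq x e lam ψ m :=
  Finset.sum_nonneg fun j _ => div_nonneg (sq_nonneg _) (h.lam_nonneg j)

theorem IsEigensystem.sub_estimator (h : IsEigensystem (empCov x) lam ψ) (e : Fin n → ℝ) (β : H)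
    {m : ℕ} (hm : ∀ j < m, 0 < lam j) :
    β - estimator x (fun i => ⟪β, x i⟫ + e i) lam ψ m
      = resid β ψ m - ∑ j ∈ Finset.range m, (noiseFun x e (ψ j) / lam j) • ψ j := by
  rw [estimator, resid, sub_sub, ← Finset.sum_add_distrib]
  congr 1
  refine Finset.sum_congr rfl fun j hj => ?_
  have hl := hm j (Finset.mem_range.mp hj)
  have h1 : ⟪crossCov x (fun i => ⟪β, x i⟫ + e i), ψ j⟫
      = lam j * ⟪β, ψ j⟫ + noiseFun x e (ψ j) := by
    rw [real_inner_comm β (ψ j) |>.symm, real_inner_comm, ← h.empForm_eigen, empForm_comm]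
    simp only [crossCov, empForm, noiseFun, inner_smul_right, inner_sum, ← mul_add,
      ← Finset.sum_add_distrib]
    congr 1
    exact Finset.sum_congr rfl fun i _ => by ring
  rw [h1, ← add_smul]
  congr 1
  field_simp

theorem IsEigensystem.empNormSq_sub_estimator (h : IsEigensystem (empCov x) lam ψ)
    (e : Fin n → ℝ) (β : H) {m : ℕ} (hm : ∀ j < m, 0 < lam j) :
    empNormSq x (β - estimator x (fun i => ⟪β, x i⟫ + e i) lam ψ m)
      = empNormSq x (resid β ψ m) + noiseSq x e lam ψ m := by
  rw [h.sub_estimator e β hm, h.empNormSq_resid_sub, noiseSq]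
  congr 1
  refine Finset.sum_congr rfl fun j hj => ?_
  have hl := hm j (Finset.mem_range.mp hj)
  field_simp

theorem contrast_eq (x : Fin n → H) (e : Fin n → ℝ) (β t : H) :
    contrast x (fun i => ⟪β, x i⟫ + e i) t
      = empNormSq x (β - t) + 2 * noiseFun x e (β - t) + (1 / (n : ℝ)) * ∑ i, e i ^ 2 := by
  simp only [contrast, empNormSq, noiseFun, inner_sub_left]
  rw [mul_left_comm, ← mul_add, ← mul_add]
  congr 1
  rw [Finset.mul_sum, ← Finset.sum_add_distrib, ← Finset.sum_add_distrib]
  exact Finset.sum_congr rfl fun i _ => by ring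

/-- The loss contributes +V and the cross term −2V. The resulting −V is the optimism of least
squares that the penalty must compensate. -/
theorem IsEigensystem.contrast_estimator (h : IsEigensystem (empCov x) lam ψ)
    (e : Fin n → ℝ) (β : H) {m : ℕ} (hm : ∀ j < m, 0 < lam j) :
    contrast x (fun i => ⟪β, x i⟫ + e i) (estimator x (fun i => ⟪β, x i⟫ + e i) lam ψ m)
      = empNormSq x (resid β ψ m) - noiseSq x e lam ψ m + 2 * noiseFun x e (resid β ψ m)
        + (1 / (n : ℝ)) * ∑ i, e i ^ 2 := by
  have h1 : noiseFun x e (β - estimator x (fun i => ⟪β, x i⟫ + e i) lam ψ m)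
      = noiseFun x e (resid β ψ m) - noiseSq x e lam ψ m := by
    rw [h.sub_estimator e β hm, sub_eq_add_neg, ← neg_one_smul ℝ, noiseFun_add, noiseFun_smul,
      noiseFun_sum, noiseSq, neg_one_mul, ← sub_eq_add_neg]
    congr 1
    refine Finset.sum_congr rfl fun j _ => ?_
    rw [noiseFun_smul]; ring
  rw [contrast_eq, h1, h.empNormSq_sub_estimator e β hm]
  ring

/-- Comparison of the loss at a minimizer `m` of the criterion with the risk at `k`. -/
theorem IsEigensystem.loss_le (h : IsEigensystem (empCov x) lam ψ) (hn : 0 < n) {θ σ : ℝ}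
    (hθ : 0 < θ) (e : Fin n → ℝ) (β : H) {m k : ℕ} (hm : ∀ j < m, 0 < lam j)
    (hk : ∀ j < k, 0 < lam j)
    (hmk : crit θ σ x (fun i => ⟪β, x i⟫ + e i) lam ψ m
      ≤ crit θ σ x (fun i => ⟪β, x i⟫ + e i) lam ψ k) {R₁ R₂ R₃ : ℝ} (hR₁ : 0 ≤ R₁)
    (h₁ : noiseSq x e lam ψ m ≤ (1 + θ / 2) * (σ ^ 2 / n) * m + R₁)
    (h₂ : residNoise x e β ψ m ≤ θ / 16 * (σ ^ 2 / n) * m + R₂)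
    (h₃ : residNoise x e β ψ k ≤ θ / 16 * (σ ^ 2 / n) * k + R₃) (hR₂ : 0 ≤ R₂) (hR₃ : 0 ≤ R₃) :
    empNormSq x (estimator x (fun i => ⟪β, x i⟫ + e i) lam ψ m - β)
      ≤ 6 * (1 + 1 / θ) * 2 *
        (empNormSq x (resid β ψ k) + pen θ σ n k + (R₁ + R₂ + R₃)) := by
  have hn' : (0 : ℝ) < n := by exact_mod_cast hn
  rw [empNormSq_sub_comm, h.empNormSq_sub_estimator e β hm]
  rw [crit, crit, h.contrast_estimator e β hm, h.contrast_estimator e β hk, pen, pen] at hmk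
  have c1 := two_mul_abs_noiseFun_le x e (resid β ψ m) hn
  have c2 := two_mul_abs_noiseFun_le x e (resid β ψ k) hn
  have c3 := neg_abs_le (noiseFun x e (resid β ψ m))
  have c4 := le_abs_self (noiseFun x e (resid β ψ k))
  have c5 := h.noiseSq_nonneg e k
  have c6 := empNormSq_nonneg x (resid β ψ m)
  have c7 := empNormSq_nonneg x (resid β ψ k)
  rw [← residNoise] at c1 c2
  rw [pen]
  have am : 0 ≤ σ ^ 2 / n * m := by positivity
  have ak : 0 ≤ σ ^ 2 / n * k := by positivity
  simp only [mul_assoc] at hmk h₁ h₂ h₃ ⊢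
  have hfin := loss_le_aux hθ am ak (B' := empNormSq x (resid β ψ k)) (B := empNormSq x (resid β ψ m))
    (V := noiseSq x e lam ψ m) c6 c7 hR₁ hR₂ hR₃ h₁ (by linarith)
  linarith

end Eigen

theorem exists_grid {ρ : ℝ} (hρ : 1 < ρ) {m : ℕ} (hm : 1 ≤ m) :
    ∃ k : ℕ, m ≤ ⌊ρ ^ (k + 1)⌋₊ ∧ (⌊ρ ^ (k + 1)⌋₊ : ℝ) ≤ ρ * m := by
  obtain ⟨k, h1, h2⟩ := exists_nat_pow_near (show (1 : ℝ) ≤ m by exact_mod_cast hm) hρ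
  refine ⟨k, Nat.le_floor h2.le, (Nat.floor_le (by positivity)).trans ?_⟩
  rw [pow_succ, mul_comm]
  gcongr

theorem maxDim_mem {n : ℕ} {s : ℝ} {lam : ℕ → ℝ} (h : 1 ≤ maxDim n s lam) :
    (maxDim n s lam : ℝ) ≤ 20 * √((n : ℝ) / Real.log n ^ 3) ∧ s ≤ lam (maxDim n s lam - 1) := by
  have hne : {N : ℕ | 1 ≤ N ∧ (N : ℝ) ≤ 20 * √((n : ℝ) / Real.log n ^ 3) ∧
      s ≤ lam (N - 1)}.Nonempty := by
    by_contra hc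
    rw [Set.not_nonempty_iff_eq_empty] at hc
    rw [maxDim, hc] at h
    simp at h
  have hb : BddAbove {N : ℕ | 1 ≤ N ∧ (N : ℝ) ≤ 20 * √((n : ℝ) / Real.log n ^ 3) ∧
      s ≤ lam (N - 1)} := ⟨⌊20 * √((n : ℝ) / Real.log n ^ 3)⌋₊, fun N hN => Nat.le_floor hN.2.1⟩
  exact (Nat.sSup_mem hne hb).2

theorem le_maxDim {n N : ℕ} {s : ℝ} {lam : ℕ → ℝ} (h1 : 1 ≤ N)
    (h2 : (N : ℝ) ≤ 20 * √((n : ℝ) / Real.log n ^ 3)) (h3 : s ≤ lam (N - 1)) :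
    N ≤ maxDim n s lam :=
  le_csSup ⟨⌊20 * √((n : ℝ) / Real.log n ^ 3)⌋₊, fun _ hN => Nat.le_floor hN.2.1⟩ ⟨h1, h2, h3⟩

theorem threshold_pos {n : ℕ} (hn : 3 ≤ n) : 0 < threshold n := by
  have hn' : (3 : ℝ) ≤ n := by exact_mod_cast hn
  -- This is where n ≥ 3 > e is needed.
  have h1 : 1 < Real.log n := by
    rw [Real.lt_log_iff_exp_lt (by linarith)]
    linarith [Real.exp_one_lt_d9]
  have h2 : 1 / Real.log n ^ 2 < 1 := by
    rw [div_lt_one (by positivity)]; nlinarith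
  rw [threshold]
  exact mul_pos (by positivity) (by linarith)

theorem threshold_le {n : ℕ} (hn : 3 ≤ n) : threshold n ≤ 2 / n := by
  have hn' : (3 : ℝ) ≤ n := by exact_mod_cast hn
  have h1 : 0 ≤ 1 / Real.log n ^ 2 := by positivity
  calc threshold n ≤ 2 / (n : ℝ) ^ 2 * 1 := by
        rw [threshold]; exact mul_le_mul_of_nonneg_left (by linarith) (by positivity)
    _ ≤ 2 / n := by
        rw [mul_one]
        exact div_le_div_of_nonneg_left (by norm_num) (by linarith) (by nlinarith)

end Design

/-! ### The geometric grid and the summability of the excess bounds. -/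

/-- Ratio of the geometric grid of dimensions. -/
noncomputable def gridRatio (θ : ℝ) : ℝ := (1 + θ / 2) / (1 + θ / 4)

theorem one_lt_gridRatio {θ : ℝ} (hθ : 0 < θ) : 1 < gridRatio θ := by
  rw [gridRatio, lt_div_iff₀ (by positivity)]; linarith

/-- The geometric grid of dimensions. -/
noncomputable def grid (θ : ℝ) (k : ℕ) : ℕ := ⌊gridRatio θ ^ (k + 1)⌋₊

theorem one_le_grid {θ : ℝ} (hθ : 0 < θ) (k : ℕ) : 1 ≤ grid θ k :=
  Nat.le_floor (by simpa using one_le_pow₀ (one_lt_gridRatio hθ).le)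

/-- Grid points are at least half the corresponding power of the ratio, since rounding down loses
less than one and they are at least one. Comparison with a geometric series then accepts every
negative exponent, in particular 1 − p/4. -/
theorem summable_grid_rpow {θ : ℝ} (hθ : 0 < θ) {s : ℝ} (hs : s < 0) :
    Summable fun k => (grid θ k : ℝ) ^ s := by
  have hρ := one_lt_gridRatio hθ
  have hρ0 : 0 < gridRatio θ := by linarith
  have hg : Summable fun k : ℕ => (gridRatio θ / 2) ^ s * (gridRatio θ ^ s) ^ k :=
    (summable_geometric_of_lt_one (by positivity)
      (Real.rpow_lt_one_of_one_lt_of_neg hρ hs)).mul_left _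
  refine Summable.of_nonneg_of_le (fun k => by positivity) (fun k => ?_) hg
  have h1 : gridRatio θ ^ (k + 1) / 2 ≤ grid θ k := by
    have h2 := Nat.lt_floor_add_one (gridRatio θ ^ (k + 1))
    have h3 : (1 : ℝ) ≤ grid θ k := by exact_mod_cast one_le_grid hθ k
    rw [grid] at h3 ⊢
    linarith
  refine (Real.rpow_le_rpow_of_nonpos (by positivity) h1 hs.le).trans (le_of_eq ?_)
  rw [Real.rpow_pow_comm hρ0.le, ← Real.mul_rpow (by positivity) (by positivity)]
  congr 1; ring

theorem summable_add_one_rpow {s : ℝ} (hs : s < -1) :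
    Summable fun m : ℕ => ((m : ℝ) + 1) ^ s := by
  have h := (summable_nat_add_iff 1).mpr (Real.summable_nat_rpow.mpr hs)
  simpa using h

/-- Constant in the bound of the expected total noise. -/
noncomputable def noiseConst (θ p : ℝ) : ℝ :=
  ∑' k, 2 ^ (p / 2) * (2 * momentConst (p / 2) ^ (p / 4)
    + 2 ^ (p / 2) * (momentConst (p / 2) ^ 2) ^ (p / 4)) / (θ / 4) ^ (p / 2 - 1)
      * (grid θ k : ℝ) ^ (1 - p / 4)
  + ∑' m : ℕ, momentConst p ^ (p / 2) / (θ / 16) ^ (p / 2 - 1) * ((m : ℝ) + 1) ^ (1 - p / 2)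

theorem noiseConst_nonneg {θ p : ℝ} (hθ : 0 < θ) (hp : 4 < p) : 0 ≤ noiseConst θ p := by
  have h1 := momentConst_pos (show 0 < p by linarith)
  have h2 := momentConst_pos (show 0 < p / 2 by linarith)
  exact add_nonneg (tsum_nonneg fun k => by positivity) (tsum_nonneg fun m => by positivity)

/-! ### From the selected dimension to the total noise. -/

section Design

variable {H : Type*} [NormedAddCommGroup H] [InnerProductSpace ℝ H] {n : ℕ}

/-- Sum of the excesses of the squared projections of the noise over their typical sizes. -/
noncomputable def totalNoise (θ σ : ℝ) (x : Fin n → H) (e : Fin n → ℝ) (β : H) (lam : ℕ → ℝ)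
    (ψ : ℕ → H) : ℝ≥0∞ :=
  ∑' k, ENNReal.ofReal (n * noiseSq x e lam ψ (grid θ k) - (1 + θ / 4) * σ ^ 2 * grid θ k)
  + ∑' m : ℕ, ENNReal.ofReal (n * residNoise x e β ψ (m + 1) - θ / 16 * σ ^ 2 * ((m : ℝ) + 1))

theorem ofReal_residNoise_le (θ σ : ℝ) (x : Fin n → H) (e : Fin n → ℝ) (β : H) (lam : ℕ → ℝ)
    (ψ : ℕ → H) {m : ℕ} (hm : 1 ≤ m) :
    ENNReal.ofReal (n * residNoise x e β ψ m - θ / 16 * σ ^ 2 * m)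
      ≤ totalNoise θ σ x e β lam ψ := by
  obtain ⟨k, rfl⟩ : ∃ k, m = k + 1 := ⟨m - 1, by omega⟩
  refine le_trans ?_ le_add_self
  refine le_trans (le_of_eq ?_) (ENNReal.le_tsum k)
  push_cast; rfl

theorem ofReal_noiseSq_le (θ σ : ℝ) (x : Fin n → H) (e : Fin n → ℝ) (β : H) (lam : ℕ → ℝ)
    (ψ : ℕ → H) (k : ℕ) :
    ENNReal.ofReal (n * noiseSq x e lam ψ (grid θ k) - (1 + θ / 4) * σ ^ 2 * grid θ k)
      ≤ totalNoise θ σ x e β lam ψ :=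
  (ENNReal.le_tsum k).trans le_self_add

theorem le_of_excess {n : ℕ} (hn : 0 < n) {v b : ℝ} :
    v ≤ b / n + max 0 (n * v - b) / n := by
  have hn' : (0 : ℝ) < n := by exact_mod_cast hn
  rw [← add_div, le_div_iff₀ hn']
  linarith [le_max_right 0 (n * v - b)]

theorem ofReal_excess_div {n : ℕ} (hn : 0 < n) {a : ℝ} {T : ℝ≥0∞} (h : ENNReal.ofReal a ≤ T) :
    ENNReal.ofReal (max 0 a / n) ≤ ENNReal.ofReal (1 / n) * T := by
  have hn' : (0 : ℝ) < n := by exact_mod_cast hn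
  rw [div_eq_inv_mul, ENNReal.ofReal_mul (by positivity), one_div]
  refine mul_le_mul_right (le_trans (le_of_eq ?_) h) _
  rcases le_total 0 a with h | h
  · rw [max_eq_right h]
  · rw [max_eq_left h, ENNReal.ofReal_zero, ENNReal.ofReal_of_nonpos h]

/-- The right-hand side does not involve `mHat`: whichever dimension is selected, its excesses are
terms of `totalNoise`, so no union bound over a random index is needed. -/
theorem IsEigensystem.selected_loss_le {x : Fin n → H} {lam : ℕ → ℝ} {ψ : ℕ → H}
    (h : IsEigensystem (empCov x) lam ψ) (hn : 3 ≤ n) {θ σ : ℝ} (hθ : 0 < θ) (e : Fin n → ℝ)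
    (β : H) {mHat : ℕ} (hsel : IsSelected θ σ x (fun i => ⟪β, x i⟫ + e i) lam ψ mHat) {m : ℕ}
    (hm : 1 ≤ m) (hmn : (m : ℝ) ≤ 20 * √((n : ℝ) / Real.log n ^ 3)) :
    ENNReal.ofReal (empNormSq x (estimator x (fun i => ⟪β, x i⟫ + e i) lam ψ mHat - β))
      ≤ ENNReal.ofReal (6 * (1 + 1 / θ) * 2) *
        (ENNReal.ofReal (empNormSq x (β - proj ψ m β)) + ENNReal.ofReal (pen θ σ n m)
          + ENNReal.ofReal (2 / n * ‖β‖ ^ 2)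
          + ENNReal.ofReal (3 / n) * totalNoise θ σ x e β lam ψ) := by
  have hn0 : 0 < n := by omega
  have hn' : (0 : ℝ) < n := by exact_mod_cast hn0
  have hthr := threshold_pos hn
  set N := maxDim n (threshold n) lam with hN
  have hbias : ∀ k, k = min m N → empNormSq x (resid β ψ k)
      ≤ empNormSq x (resid β ψ m) + 2 / n * ‖β‖ ^ 2 := by
    intro k hk
    refine (h.empNormSq_resid_le β (hk ▸ min_le_left _ _) hthr.le ?_).trans ?_
    · intro j hj hjm
      by_contra! hc
      -- Index `j` carries the eigenvalue number `j + 1`. If it exceeded the threshold, dimension `j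
      -- + 1 ≤ m` would be admissible, contradicting N ≤ j.
      have h1 : j + 1 ≤ N := by
        refine le_maxDim (by omega) (le_trans ?_ hmn) hc.le
        exact_mod_cast hjm
      omega
    · have := threshold_le hn
      gcongr
  have hresid : β - proj ψ m β = resid β ψ m := by rw [h.proj_apply, resid]
  have hC1 : 1 ≤ 6 * (1 + 1 / θ) * 2 := by
    have : 0 < 1 / θ := by positivity
    linarith
  have hpen : 0 ≤ pen θ σ n m := by rw [pen]; positivity
  have hb := empNormSq_nonneg x (resid β ψ m)
  rw [hresid]
  rcases Nat.eq_zero_or_pos N with hN0 | hN1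
  -- Without any model the estimator is 0 and its loss is the bias in dimension 0.
  · have h0 := hsel.1 hN0
    have h1 := hbias 0 (by omega)
    have e0 : empNormSq x (estimator x (fun i => ⟪β, x i⟫ + e i) lam ψ mHat - β)
        = empNormSq x (resid β ψ 0) := by
      rw [h0, empNormSq_sub_comm]; simp [estimator, resid]
    rw [e0]
    calc ENNReal.ofReal (empNormSq x (resid β ψ 0))
        ≤ ENNReal.ofReal 1 * ENNReal.ofReal (empNormSq x (resid β ψ m) + 2 / n * ‖β‖ ^ 2) := by
          rw [ENNReal.ofReal_one, one_mul]; exact ENNReal.ofReal_le_ofReal h1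
      _ ≤ _ := by
          refine mul_le_mul' (ENNReal.ofReal_le_ofReal hC1) ?_
          rw [ENNReal.ofReal_add hb (by positivity)]
          refine le_trans ?_ le_self_add
          gcongr
          exact le_self_add
  · obtain ⟨hmem, hmin⟩ := hsel.2 hN1
    obtain ⟨hm1, hmN⟩ := Finset.mem_Icc.mp hmem
    have hpos : ∀ k ≤ N, ∀ j < k, 0 < lam j := fun k hk j hj =>
      hthr.trans_le ((maxDim_mem hN1).2.trans (h.antitone (by omega)))
    set k := min m N with hk
    have hkN : k ≤ N := min_le_right _ _
    have hk1 : 1 ≤ k := le_min hm hN1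
    have hcrit := hmin k (Finset.mem_Icc.mpr ⟨hk1, hkN⟩)
    obtain ⟨l, hl1, hl2⟩ := exists_grid (one_lt_gridRatio hθ) hm1
    change mHat ≤ grid θ l at hl1
    change (grid θ l : ℝ) ≤ _ at hl2
    set T := totalNoise θ σ x e β lam ψ
    set R₁ : ℝ := max 0 (n * noiseSq x e lam ψ (grid θ l) - (1 + θ / 4) * σ ^ 2 * grid θ l) / n with hR₁
    set R₂ : ℝ := max 0 (n * residNoise x e β ψ mHat - θ / 16 * σ ^ 2 * mHat) / n with hR₂
    set R₃ : ℝ := max 0 (n * residNoise x e β ψ k - θ / 16 * σ ^ 2 * k) / n with hR₃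
    have t₁ : ENNReal.ofReal R₁ ≤ ENNReal.ofReal (1 / n) * T :=
      ofReal_excess_div hn0 (ofReal_noiseSq_le θ σ x e β lam ψ l)
    have t₂ : ENNReal.ofReal R₂ ≤ ENNReal.ofReal (1 / n) * T :=
      ofReal_excess_div hn0 (ofReal_residNoise_le θ σ x e β lam ψ hm1)
    have t₃ : ENNReal.ofReal R₃ ≤ ENNReal.ofReal (1 / n) * T :=
      ofReal_excess_div hn0 (ofReal_residNoise_le θ σ x e β lam ψ hk1)
    have p₁ : 0 ≤ R₁ := by positivity
    have p₂ : 0 ≤ R₂ := by positivity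
    have p₃ : 0 ≤ R₃ := by positivity
    have g₁ : noiseSq x e lam ψ mHat ≤ (1 + θ / 2) * (σ ^ 2 / n) * mHat + R₁ := by
      refine (h.noiseSq_mono e hl1).trans ((le_of_excess hn0).trans
        (add_le_add_left (?_ : (1 + θ / 4) * σ ^ 2 * grid θ l / n ≤ _) _))
      -- The grid ratio is chosen precisely so that rounding `mHat` up to the grid costs the passage
      -- from θ/4 to θ/2.
      have e1 : (1 + θ / 2) = (1 + θ / 4) * gridRatio θ := by rw [gridRatio]; field_simp
      rw [e1]
      calc (1 + θ / 4) * σ ^ 2 * grid θ l / n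
          ≤ (1 + θ / 4) * σ ^ 2 * (gridRatio θ * mHat) / n := by gcongr
        _ = _ := by ring
    have g₂ : residNoise x e β ψ mHat ≤ θ / 16 * (σ ^ 2 / n) * mHat + R₂ := by
      refine (le_of_excess hn0 (b := θ / 16 * σ ^ 2 * mHat)).trans (le_of_eq ?_)
      rw [hR₂]; ring
    have g₃ : residNoise x e β ψ k ≤ θ / 16 * (σ ^ 2 / n) * k + R₃ := by
      refine (le_of_excess hn0 (b := θ / 16 * σ ^ 2 * k)).trans (le_of_eq ?_)
      rw [hR₃]; ring
    have hloss := h.loss_le hn0 hθ e β (hpos mHat hmN) (hpos k hkN) hcrit p₁ g₁ g₂ g₃ p₂ p₃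
    have hpk : pen θ σ n k ≤ pen θ σ n m := by
      rw [pen, pen]
      have : (k : ℝ) ≤ m := by exact_mod_cast min_le_left m N
      gcongr
    have hbk := hbias k hk
    refine (ENNReal.ofReal_le_ofReal (hloss.trans (mul_le_mul_of_nonneg_left
      (show _ ≤ (empNormSq x (resid β ψ m) + pen θ σ n m + 2 / n * ‖β‖ ^ 2) + (R₁ + R₂ + R₃) by
        linarith) (by positivity)))).trans ?_
    rw [ENNReal.ofReal_mul (by positivity), ENNReal.ofReal_add (by positivity) (by positivity),
      ENNReal.ofReal_add (by positivity) (by positivity), ENNReal.ofReal_add hb hpen,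
      ENNReal.ofReal_add (by positivity) p₃, ENNReal.ofReal_add p₁ p₂]
    refine mul_le_mul_right (add_le_add_right ?_ _) _
    calc _ ≤ ENNReal.ofReal (1 / n) * T + ENNReal.ofReal (1 / n) * T
          + ENNReal.ofReal (1 / n) * T := by gcongr
      _ = _ := by
        rw [← add_mul, ← add_mul, ← ENNReal.ofReal_add (by positivity) (by positivity),
          ← ENNReal.ofReal_add (by positivity) (by positivity)]
        congr 2; ring

end Design

/-! ### Expected total noise and independence of design and noise. -/

section Expectation

variable {Ω : Type*} [MeasurableSpace Ω] {P : Measure Ω}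

/-- For orthogonal vectors of norm at most one, Q = Σ w_j w_jᵀ satisfies (Q²)_ii ≤ Q_ii and has
trace at most `M`. Norms below one are allowed because null empirical directions give the zero
vector. -/
theorem orthogonal_forms_tail [IsProbabilityMeasure P] {p δ : ℝ} (hp : 4 < p) (hδ : 0 < δ)
    {ε : ℕ → Ω → ℝ} (hind : iIndepFun ε P) (hε : ∀ k, Measurable (ε k)) {τ σ : ℝ} (hσ : 0 < σ)
    (hεp : ∀ k, Integrable (fun ω => |ε k ω| ^ p) P)
    (hετ : ∀ k, ∫ ω, |ε k ω| ^ p ∂P ≤ τ) (hε0 : ∀ k, ∫ ω, ε k ω ∂P = 0)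
    (hε2 : ∀ k, ∫ ω, ε k ω ^ 2 ∂P = σ ^ 2)
    (n : ℕ) (w : ℕ → ℕ → ℝ) (hw : ∀ j k, j ≠ k → ∑ i ∈ Finset.range n, w j i * w k i = 0)
    (hw1 : ∀ j, ∑ i ∈ Finset.range n, w j i ^ 2 ≤ 1) {M : ℕ} (hM : 0 < M) :
    ∫⁻ ω, ENNReal.ofReal (∑ j ∈ Finset.range M, (∑ i ∈ Finset.range n, w j i * ε i ω) ^ 2
        - (1 + δ) * σ ^ 2 * M) ∂P
      ≤ ENNReal.ofReal (2 ^ (p / 2) * (2 * momentConst (p / 2) ^ (p / 4)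
          + 2 ^ (p / 2) * (momentConst (p / 2) ^ 2) ^ (p / 4)) / δ ^ (p / 2 - 1)
          * (M : ℝ) ^ (1 - p / 4) * (τ / σ ^ p * σ ^ 2)) := by
  have h := quadratic_form_tail hp hδ hind hε hσ hεp hετ hε0 hε2 n
    (fun i k => ∑ j ∈ Finset.range M, w j i * w j k)
    (fun i k => Finset.sum_congr rfl fun j _ => mul_comm _ _)
    (fun i _ => ?_) (M := M) (by exact_mod_cast hM) ?_
  · refine le_trans (le_of_eq ?_) h
    congr 1
    funext ω
    congr 2
    have e : ∀ j, (∑ i ∈ Finset.range n, w j i * ε i ω) ^ 2 = ∑ i ∈ Finset.range n,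
        ∑ k ∈ Finset.range n, w j i * ε i ω * (w j k * ε k ω) := fun j => by
      rw [sq, Finset.sum_mul_sum]
    simp only [e, Finset.sum_mul]
    rw [Finset.sum_comm]
    refine Finset.sum_congr rfl fun i _ => ?_
    rw [Finset.sum_comm]
    exact Finset.sum_congr rfl fun k _ => Finset.sum_congr rfl fun j _ => by ring
  · calc ∑ k ∈ Finset.range n, (∑ j ∈ Finset.range M, w j i * w j k) ^ 2
        = ∑ j ∈ Finset.range M, ∑ l ∈ Finset.range M,
            w j i * w l i * ∑ k ∈ Finset.range n, w j k * w l k := by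
          have e : ∀ k, (∑ j ∈ Finset.range M, w j i * w j k) ^ 2 = ∑ j ∈ Finset.range M,
              ∑ l ∈ Finset.range M, w j i * w j k * (w l i * w l k) := fun k => by
            rw [sq, Finset.sum_mul_sum]
          simp only [e, Finset.mul_sum]
          rw [Finset.sum_comm]
          refine Finset.sum_congr rfl fun j _ => ?_
          rw [Finset.sum_comm]
          exact Finset.sum_congr rfl fun k _ => Finset.sum_congr rfl fun j _ => by ring
      _ = ∑ j ∈ Finset.range M, w j i * w j i * ∑ k ∈ Finset.range n, w j k ^ 2 := by
          refine Finset.sum_congr rfl fun j hj => ?_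
          rw [Finset.sum_eq_single_of_mem j hj fun l _ hl => by rw [hw j l hl.symm, mul_zero]]
          simp only [sq]
      _ ≤ ∑ j ∈ Finset.range M, w j i * w j i :=
          Finset.sum_le_sum fun j _ => mul_le_of_le_one_right (mul_self_nonneg _) (hw1 j)
  · rw [Finset.sum_comm]
    calc _ ≤ ∑ j ∈ Finset.range M, (1 : ℝ) :=
          Finset.sum_le_sum fun j _ => by simpa only [sq] using hw1 j
      _ = M := by simp

variable {H : Type*} [NormedAddCommGroup H] [InnerProductSpace ℝ H] {n : ℕ}

/-- Extension by zero of the vector of normalized coordinates `⟨f, xᵢ⟩ / √(n a)`. -/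
noncomputable def coordSeq (x : Fin n → H) (f : H) (a : ℝ) (i : ℕ) : ℝ :=
  if h : i < n then ⟪f, x ⟨i, h⟩⟫ / √(n * a) else 0

theorem sum_coordSeq_mul (x : Fin n → H) (f g : H) (a b : ℝ) (hn : 0 < n) :
    ∑ i ∈ Finset.range n, coordSeq x f a i * coordSeq x g b i
      = n * empForm x f g / (√(n * a) * √(n * b)) := by
  have hn' : (0 : ℝ) < n := by exact_mod_cast hn
  rw [Finset.sum_range, empForm, ← mul_assoc, mul_one_div_cancel hn'.ne', one_mul, Finset.sum_div]
  refine Finset.sum_congr rfl fun i _ => ?_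
  simp only [coordSeq, i.2, dif_pos, Fin.eta]
  rw [div_mul_div_comm]

theorem sum_coordSeq_sq_le (x : Fin n → H) (f : H) (hn : 0 < n) :
    ∑ i ∈ Finset.range n, coordSeq x f (empNormSq x f) i ^ 2 ≤ 1 := by
  simp only [sq]
  rw [sum_coordSeq_mul x f f _ _ hn, empForm_self,
    Real.mul_self_sqrt (mul_nonneg (by positivity) (empNormSq_nonneg _ _))]
  exact div_self_le_one _

theorem sum_coordSeq_sq_eq (x : Fin n → H) (f : H) {a : ℝ} (ha : 0 ≤ a) (e : ℕ → ℝ) (hn : 0 < n) :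
    (∑ i ∈ Finset.range n, coordSeq x f a i * e i) ^ 2
      = n * (noiseFun x (fun i => e i) f ^ 2 / a) := by
  have hn' : (0 : ℝ) < n := by exact_mod_cast hn
  have h1 : ∑ i ∈ Finset.range n, coordSeq x f a i * e i
      = n * noiseFun x (fun i => e i) f / √(n * a) := by
    rw [Finset.sum_range, noiseFun, ← mul_assoc, mul_one_div_cancel hn'.ne', one_mul,
      Finset.sum_div]
    refine Finset.sum_congr rfl fun i _ => ?_
    simp only [coordSeq, i.2, dif_pos, Fin.eta]
    ring
  rw [h1, div_pow, Real.sq_sqrt (by positivity)]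
  rcases ha.eq_or_lt with h | h
  · rw [← h]; simp
  · field_simp

theorem measurable_totalNoise [SecondCountableTopology H] [MeasurableSpace H] [BorelSpace H]
    (θ σ : ℝ) (β : H) {lamHat : (Fin n → H) → ℕ → ℝ} {ψHat : (Fin n → H) → ℕ → H}
    (hψ : ∀ j, Measurable fun x => ψHat x j)
    (heig : ∀ x, IsEigensystem (empCov x) (lamHat x) (ψHat x)) :
    Measurable fun z : (Fin n → H) × (Fin n → ℝ) =>
      totalNoise θ σ z.1 z.2 β (lamHat z.1) (ψHat z.1) := by
  have hψ' : ∀ j, Measurable fun z : (Fin n → H) × (Fin n → ℝ) => ψHat z.1 j :=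
    fun j => (hψ j).comp measurable_fst
  have hnoise : ∀ f : (Fin n → H) × (Fin n → ℝ) → H, Measurable f →
      Measurable fun z => noiseFun z.1 z.2 (f z) := fun f hf => by
    unfold noiseFun
    refine measurable_const.mul (Finset.measurable_sum _ fun i _ => ?_)
    exact (by fun_prop : Measurable fun z : (Fin n → H) × (Fin n → ℝ) => z.2 i).mul
      (hf.inner (by fun_prop))
  have hnorm : ∀ f : (Fin n → H) × (Fin n → ℝ) → H, Measurable f →
      Measurable fun z => empNormSq z.1 (f z) := fun f hf => by
    unfold empNormSq
    refine measurable_const.mul (Finset.measurable_sum _ fun i _ => ?_)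
    exact (hf.inner (by fun_prop)).pow_const 2
  have hlam : ∀ j, Measurable fun z : (Fin n → H) × (Fin n → ℝ) => lamHat z.1 j := fun j => by
    -- Eigenvalues inherit measurability from the eigenvectors, being their squared empirical norms.
    simp only [fun x => (heig x).lam_eq j]
    exact hnorm _ (hψ' j)
  have hres : ∀ m, Measurable fun z : (Fin n → H) × (Fin n → ℝ) => resid β (ψHat z.1) m :=
    fun m => by
      unfold resid
      refine measurable_const.sub (Finset.measurable_sum _ fun j _ => ?_)
      exact (measurable_const.inner (hψ' j)).smul (hψ' j)
  unfold totalNoise noiseSq residNoise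
  refine (Measurable.tsum fun k => ?_).add (Measurable.tsum fun m => ?_)
  · refine ENNReal.measurable_ofReal.comp (Measurable.sub_const (Measurable.const_mul ?_ _) _)
    exact Finset.measurable_sum _ fun j _ => ((hnoise _ (hψ' j)).pow_const 2).div (hlam j)
  · refine ENNReal.measurable_ofReal.comp (Measurable.sub_const (Measurable.const_mul ?_ _) _)
    exact ((hnoise _ (hres _)).pow_const 2).div (hnorm _ (hres _))

theorem totalNoise_zero (θ : ℝ) (x : Fin n → H) (β : H) (lam : ℕ → ℝ) (ψ : ℕ → H) :
    totalNoise θ 0 x 0 β lam ψ = 0 := by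
  simp [totalNoise, noiseSq, residNoise, noiseFun]

/-- Bound of the expected total noise for a fixed design. -/
theorem lintegral_totalNoise_le [IsProbabilityMeasure P] {θ p : ℝ} (hθ : 0 < θ) (hp : 4 < p)
    {ε : ℕ → Ω → ℝ} (hind : iIndepFun ε P) (hε : ∀ k, Measurable (ε k)) {τ σ : ℝ} (hσ : 0 ≤ σ)
    (hεp : ∀ k, Integrable (fun ω => |ε k ω| ^ p) P)
    (hετ : ∀ k, ∫ ω, |ε k ω| ^ p ∂P ≤ τ) (hε0 : ∀ k, ∫ ω, ε k ω ∂P = 0)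
    (hε2 : ∀ k, ∫ ω, ε k ω ^ 2 ∂P = σ ^ 2) (hn : 0 < n) (x : Fin n → H) (β : H)
    {lam : ℕ → ℝ} {ψ : ℕ → H} (h : IsEigensystem (empCov x) lam ψ) :
    ∫⁻ ω, totalNoise θ σ x (fun i => ε i ω) β lam ψ ∂P
      ≤ ENNReal.ofReal (noiseConst θ p * (τ / σ ^ p * σ ^ 2)) := by
  have hτ : 0 ≤ τ := (integral_nonneg fun ω => by positivity).trans (hετ 0)
  -- For σ = 0 the noise vanishes almost surely, and so does the total noise.
  rcases hσ.eq_or_lt with rfl | hσ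
  · have hz : ∀ k, ∀ᵐ ω ∂P, ε k ω = 0 := fun k => by
      have hI : Integrable (fun ω => ε k ω ^ 2) P := by
        have := integrable_rpow_mul (P := P) (q := p) (s := 2) (by norm_num) (by linarith)
          (U := fun _ => 1) measurable_const (hε k) (by simp) (hεp k)
        simpa using this
      have h0 := (integral_eq_zero_iff_of_nonneg (fun ω => sq_nonneg (ε k ω)) hI).mp
        (by rw [hε2]; simp)
      filter_upwards [h0] with ω hω using by simpa using hω
    have : ∀ᵐ ω ∂P, totalNoise θ 0 x (fun i => ε i ω) β lam ψ = 0 := by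
      filter_upwards [ae_all_iff.mpr hz] with ω hω
      have : (fun i : Fin n => ε i ω) = 0 := funext fun i => hω i
      rw [this, totalNoise_zero]
    rw [lintegral_congr_ae this]
    simp
  have hK1 := momentConst_pos (show 0 < p by linarith)
  have hK2 := momentConst_pos (show 0 < p / 2 by linarith)
  have mn : ∀ f : H, Measurable fun ω => noiseFun x (fun i => ε i ω) f := fun f => by
    unfold noiseFun; fun_prop
  have mA : ∀ k : ℕ, Measurable fun ω => ENNReal.ofReal
      (n * noiseSq x (fun i => ε i ω) lam ψ (grid θ k) - (1 + θ / 4) * σ ^ 2 * grid θ k) :=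
    fun k => by unfold noiseSq; fun_prop
  have mB : ∀ m : ℕ, Measurable fun ω => ENNReal.ofReal
      (n * residNoise x (fun i => ε i ω) β ψ (m + 1) - θ / 16 * σ ^ 2 * ((m : ℝ) + 1)) :=
    fun m => by unfold residNoise; fun_prop
  have hr : 0 ≤ τ / σ ^ p * σ ^ 2 := by positivity
  rw [noiseConst, add_mul, ← tsum_mul_right, ← tsum_mul_right,
    ENNReal.ofReal_add (tsum_nonneg fun k => by positivity) (tsum_nonneg fun k => by positivity),
    ENNReal.ofReal_tsum_of_nonneg (fun k => by positivity)
      (((summable_grid_rpow hθ (by linarith)).mul_left _).mul_right _),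
    ENNReal.ofReal_tsum_of_nonneg (fun k => by positivity)
      (((summable_add_one_rpow (by linarith)).mul_left _).mul_right _)]
  simp only [totalNoise]
  rw [lintegral_add_left (Measurable.tsum mA), lintegral_tsum fun k => (mA k).aemeasurable,
    lintegral_tsum fun k => (mB k).aemeasurable]
  refine add_le_add (ENNReal.tsum_le_tsum fun k => ?_) (ENNReal.tsum_le_tsum fun m => ?_)
  · have := orthogonal_forms_tail hp (show 0 < θ / 4 by positivity) hind hε hσ hεp hετ hε0 hε2 n
      (fun j => coordSeq x (ψ j) (lam j)) (fun j k hjk => ?_) (fun j => ?_) (one_le_grid hθ k)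
    · refine le_trans (le_of_eq ?_) this
      congr 1
      funext ω
      congr 2
      rw [noiseSq, Finset.mul_sum]
      exact Finset.sum_congr rfl fun j _ =>
        (sum_coordSeq_sq_eq x (ψ j) (h.lam_nonneg j) (fun i => ε i ω) hn).symm
    · rw [sum_coordSeq_mul _ _ _ _ _ hn, h.empForm_eigen, h.inner_eq, if_neg hjk]; simp
    · rw [h.lam_eq]; exact sum_coordSeq_sq_le x (ψ j) hn
  · have := linear_form_tail hp (show 0 < θ / 16 by positivity) hind hε hσ hεp hετ hε0 n
      (coordSeq x (resid β ψ (m + 1)) (empNormSq x (resid β ψ (m + 1))))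
      (sum_coordSeq_sq_le x _ hn) (M := (m : ℝ) + 1) (by positivity)
    refine le_trans (le_of_eq ?_) this
    congr 1
    funext ω
    congr 2
    rw [sum_coordSeq_sq_eq x _ (empNormSq_nonneg _ _) (fun i => ε i ω) hn, residNoise]

/-- Under independence the joint law is a product, so Tonelli reduces to a bound uniform in the
frozen first variable, here the design. -/
theorem lintegral_comp_le_of_indepFun [IsProbabilityMeasure P] {α γ : Type*} [MeasurableSpace α]
    [MeasurableSpace γ] {f : Ω → α} {g : Ω → γ} (hf : Measurable f) (hg : Measurable g)
    (hfg : IndepFun f g P) {F : α × γ → ℝ≥0∞} (hF : Measurable F) {b : ℝ≥0∞}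
    (hb : ∀ a, ∫⁻ ω, F (a, g ω) ∂P ≤ b) : ∫⁻ ω, F (f ω, g ω) ∂P ≤ b := by
  have h1 := (indepFun_iff_map_prod_eq_prod_map_map hf.aemeasurable hg.aemeasurable).mp hfg
  have : IsProbabilityMeasure (P.map f) := Measure.isProbabilityMeasure_map hf.aemeasurable
  have : IsProbabilityMeasure (P.map g) := Measure.isProbabilityMeasure_map hg.aemeasurable
  rw [← lintegral_map hF (hf.prodMk hg), h1, lintegral_prod _ hF.aemeasurable]
  calc _ ≤ ∫⁻ _, b ∂(P.map f) := lintegral_mono fun a => by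
        rw [lintegral_map (by fun_prop) hg]; exact hb a
    _ = b := by simp

/-- If the pairs `(Xᵢ, εᵢ)` are i.i.d. with independent components, then the vectors
`(X₀, …)` and `(ε₀, …)` are independent. -/
theorem indepFun_vectors [IsProbabilityMeasure P] {α γ : Type*} [MeasurableSpace α]
    [MeasurableSpace γ] {X : ℕ → Ω → α} {ε : ℕ → Ω → γ} (hX : ∀ i, Measurable (X i))
    (hε : ∀ i, Measurable (ε i)) (hind : iIndepFun (fun i ω => (X i ω, ε i ω)) P)
    (hident : ∀ i, IdentDistrib (fun ω => (X i ω, ε i ω)) (fun ω => (X 0 ω, ε 0 ω)) P P)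
    (hXε : IndepFun (X 0) (ε 0) P) (n : ℕ) :
    IndepFun (fun ω (i : Fin n) => X i ω) (fun ω (i : Fin n) => ε i ω) P := by
  have hindn : iIndepFun (fun (i : Fin n) ω => (X i ω, ε i ω)) P :=
    hind.precomp (g := fun i : Fin n => (i : ℕ)) Fin.val_injective
  have hindX : iIndepFun (fun (i : Fin n) ω => X i ω) P :=
    hindn.comp (fun _ z => z.1) fun _ => measurable_fst
  have hindε : iIndepFun (fun (i : Fin n) ω => ε i ω) P :=
    hindn.comp (fun _ z => z.2) fun _ => measurable_snd
  have m1 := (iIndepFun_iff_map_fun_eq_pi_map fun i : Fin n =>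
    ((hX i).prodMk (hε i)).aemeasurable).mp hindn
  have m2 := (iIndepFun_iff_map_fun_eq_pi_map fun i : Fin n => (hX i).aemeasurable).mp hindX
  have m3 := (iIndepFun_iff_map_fun_eq_pi_map fun i : Fin n => (hε i).aemeasurable).mp hindε
  have hpair : ∀ i, P.map (fun ω => (X i ω, ε i ω)) = (P.map (X i)).prod (P.map (ε i)) := by
    intro i
    have e1 : P.map (X i) = P.map (X 0) := ((hident i).comp measurable_fst).map_eq
    have e2 : P.map (ε i) = P.map (ε 0) := ((hident i).comp measurable_snd).map_eq
    rw [(hident i).map_eq, e1, e2]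
    exact (indepFun_iff_map_prod_eq_prod_map_map (hX 0).aemeasurable (hε 0).aemeasurable).mp hXε
  have pX : ∀ i, IsProbabilityMeasure (P.map (X i)) := fun i =>
    Measure.isProbabilityMeasure_map (hX i).aemeasurable
  have pε : ∀ i, IsProbabilityMeasure (P.map (ε i)) := fun i =>
    Measure.isProbabilityMeasure_map (hε i).aemeasurable
  rw [indepFun_iff_map_prod_eq_prod_map_map (by fun_prop) (by fun_prop), m2, m3,
    -- A product of pair laws, each itself a product, is rearranged into the product of the two
    -- vector laws.
    ← (measurePreserving_arrowProdEquivProdArrow α γ (Fin n) _ _).map_eq]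
  simp only [← hpair]
  rw [← m1, Measure.map_map (MeasurableEquiv.measurable _) (by fun_prop)]
  rfl

end Expectation

end FPCR

/-- Oracle inequality in the empirical semi-norm, known noise variance. The first `n` pairs of the
sample are `X i`, `Y i = ⟪β, X i⟫ + ε i`, `i = 0, …, n - 1`. -/
theorem proposition1 (θ p : ℝ) (hθ : 0 < θ) (hp : 4 < p) :
    ∃ C C' : ℝ, 0 < C ∧ 0 < C' ∧
      ∀ (H : Type u) [NormedAddCommGroup H] [InnerProductSpace ℝ H] [CompleteSpace H]
        [SecondCountableTopology H] [MeasurableSpace H] [BorelSpace H]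
        (Ω : Type v) [MeasurableSpace Ω] (P : Measure Ω) [IsProbabilityMeasure P]
        -- the sample
        (X : ℕ → Ω → H) (ε : ℕ → Ω → ℝ) (β : H) (σ : ℝ)
        (_hX : ∀ i, Measurable (X i)) (_hε : ∀ i, Measurable (ε i))
        (_hindep : iIndepFun (fun i ω => (X i ω, ε i ω)) P)
        (_hident : ∀ i, IdentDistrib (fun ω => (X i ω, ε i ω)) (fun ω => (X 0 ω, ε 0 ω)) P P)
        (_hXε : IndepFun (X 0) (ε 0) P)
        (_hX2 : MemLp (X 0) 2 P) (_hX0 : ∫ ω, X 0 ω ∂P = 0)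
        -- noise: centred, with variance `σ²` and a finite moment of order `p`
        (_hσ : 0 ≤ σ) (_hεp : Integrable (fun ω => |ε 0 ω| ^ p) P)
        (_hε0 : ∫ ω, ε 0 ω ∂P = 0) (_hε2 : variance (ε 0) P = σ ^ 2)
        -- eigenelements of the covariance operator
        (lam : ℕ → ℝ) (ψ : ℕ → H) (_heig : FPCR.IsEigensystem (FPCR.covOp P (X 0)) lam ψ)
        -- sample size, and eigenelements of the empirical covariance operator, as measurable
        -- functions of the design
        (n : ℕ) (_hn : 3 ≤ n)
        (lamHat : (Fin n → H) → ℕ → ℝ) (ψHat : (Fin n → H) → ℕ → H)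
        (_hψHat : ∀ j, Measurable fun x => ψHat x j)
        (_heigHat : ∀ x, FPCR.IsEigensystem (FPCR.empCov x) (lamHat x) (ψHat x))
        -- selected dimension
        (mHat : Ω → ℕ) (_hmHat : Measurable mHat)
        (_hsel : ∀ᵐ ω ∂P, FPCR.IsSelected θ σ (fun i : Fin n => X i ω)
          (fun i : Fin n => ⟪β, X i ω⟫ + ε i ω)
          (lamHat fun i => X i ω) (ψHat fun i => X i ω) (mHat ω)),
        ∫⁻ ω, ENNReal.ofReal (FPCR.empNormSq (fun i : Fin n => X i ω)
            (FPCR.estimator (fun i : Fin n => X i ω) (fun i : Fin n => ⟪β, X i ω⟫ + ε i ω)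
              (lamHat fun i => X i ω) (ψHat fun i => X i ω) (mHat ω) - β)) ∂P
          ≤ ENNReal.ofReal C *
              (⨅ m ∈ Finset.Icc 1 (FPCR.maxDim n (1 / (n : ℝ) ^ 2) lam),
                (∫⁻ ω, ENNReal.ofReal (FPCR.empNormSq (fun i : Fin n => X i ω)
                    (β - FPCR.proj (ψHat fun i => X i ω) m β)) ∂P
                  + ENNReal.ofReal (FPCR.pen θ σ n m)))
            + ENNReal.ofReal
                (C' * ((∫ ω, |ε 0 ω| ^ p ∂P) / σ ^ p * σ ^ 2 + ‖β‖ ^ 2) / n) := by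
  set A : ℝ := 6 * (1 + 1 / θ) * 2 with hA
  have hA0 : 0 < A := by positivity
  have hK := FPCR.noiseConst_nonneg hθ hp
  set K := FPCR.noiseConst θ p
  -- The 2 comes from the threshold bound 2/n, and 3K from the three excess terms, each at most a
  -- multiple 1/n of the total noise.
  refine ⟨A, A * (2 + 3 * K), hA0, by positivity, ?_⟩
  intro H _ _ _ _ _ _ Ω _ P _ X ε β σ hX hε hindep hident hXε _ _ hσ hεp hε0 hε2 lam ψ _ n hn
    lamHat ψHat hψHat heigHat mHat _ hsel
  have hn' : (0 : ℝ) < n := by exact_mod_cast (by omega : 0 < n)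
  have hidε : ∀ i, IdentDistrib (ε i) (ε 0) P P := fun i => (hident i).comp measurable_snd
  have hεpow : ∀ i, IdentDistrib (fun ω => |ε i ω| ^ p) (fun ω => |ε 0 ω| ^ p) P P := fun i =>
    (hidε i).comp (u := fun z : ℝ => |z| ^ p) (by fun_prop)
  have hεsq : ∀ i, IdentDistrib (fun ω => ε i ω ^ 2) (fun ω => ε 0 ω ^ 2) P P := fun i =>
    (hidε i).comp (u := fun z : ℝ => z ^ 2) (by fun_prop)
  have hindε : iIndepFun ε P := hindep.comp (fun _ z => z.2) fun _ => measurable_snd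
  set τ := ∫ ω, |ε 0 ω| ^ p ∂P
  have hτ : 0 ≤ τ := integral_nonneg fun ω => by positivity
  set r := τ / σ ^ p * σ ^ 2 with hr
  have hr0 : 0 ≤ r := by positivity
  set T : Ω → ℝ≥0∞ := fun ω => FPCR.totalNoise θ σ (fun i : Fin n => X i ω)
    (fun i : Fin n => ε i ω) β (lamHat fun i => X i ω) (ψHat fun i => X i ω) with hT
  have hmeas := FPCR.measurable_totalNoise θ σ β hψHat heigHat
  have hXv : Measurable fun ω (i : Fin n) => X i ω := measurable_pi_lambda _ fun i => hX i
  have hεv : Measurable fun ω (i : Fin n) => ε i ω := measurable_pi_lambda _ fun i => hε i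
  have hTm : Measurable T := by
    have h := hmeas.comp (hXv.prodMk hεv)
    exact h
  have hfix : ∀ x : Fin n → H, ∫⁻ ω, FPCR.totalNoise θ σ x (fun i : Fin n => ε i ω) β (lamHat x)
      (ψHat x) ∂P ≤ ENNReal.ofReal (K * r) := fun x =>
    FPCR.lintegral_totalNoise_le hθ hp hindε hε hσ
      (fun k => (hεpow k).integrable_iff.mpr hεp) (fun k => (hεpow k).integral_eq.le)
      (fun k => (hidε k).integral_eq.trans hε0)
      (fun k => (hεsq k).integral_eq.trans
        ((variance_of_integral_eq_zero (hε 0).aemeasurable hε0).symm.trans hε2))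
      (by omega) x β (heigHat x)
  have hTle := FPCR.lintegral_comp_le_of_indepFun hXv hεv
    (FPCR.indepFun_vectors hX hε hindep hident hXε n) hmeas hfix
  change ∫⁻ ω, T ω ∂P ≤ _ at hTle
  have hA1 : ENNReal.ofReal A ≠ 0 := by simpa using hA0
  -- Isolating the infimum reduces the claim to each fixed `m` and covers the empty collection,
  -- whose infimum is ∞.
  rw [← tsub_le_iff_right, ← ENNReal.div_le_iff' hA1 ENNReal.ofReal_ne_top]
  refine le_iInf₂ fun m hm => ?_
  rw [ENNReal.div_le_iff' hA1 ENNReal.ofReal_ne_top, tsub_le_iff_right]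
  obtain ⟨hm1, hmN⟩ := Finset.mem_Icc.mp hm
  have hmn : (m : ℝ) ≤ 20 * √((n : ℝ) / Real.log n ^ 3) :=
    le_trans (by exact_mod_cast hmN) (FPCR.maxDim_mem (hm1.trans hmN)).1
  set b : Ω → ℝ≥0∞ := fun ω => ENNReal.ofReal (FPCR.empNormSq (fun i : Fin n => X i ω)
    (β - FPCR.proj (ψHat fun i => X i ω) m β)) with hb
  have hconst : ENNReal.ofReal A * (ENNReal.ofReal (2 / n * ‖β‖ ^ 2)
      + ENNReal.ofReal (3 / n) * ENNReal.ofReal (K * r))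
      ≤ ENNReal.ofReal (A * (2 + 3 * K) * (r + ‖β‖ ^ 2) / n) := by
    rw [← ENNReal.ofReal_mul (by positivity), ← ENNReal.ofReal_add (by positivity) (by positivity),
      ← ENNReal.ofReal_mul hA0.le]
    refine ENNReal.ofReal_le_ofReal ?_
    have e1 : A * (2 / n * ‖β‖ ^ 2 + 3 / n * (K * r)) = A * (2 * ‖β‖ ^ 2 + 3 * K * r) / n := by
      ring
    rw [e1, mul_assoc A (2 + 3 * K)]
    have h1 : 0 ≤ K * ‖β‖ ^ 2 := by positivity
    refine div_le_div_of_nonneg_right (mul_le_mul_of_nonneg_left ?_ hA0.le) hn'.le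
    linarith [mul_nonneg hK hr0]
  calc _ ≤ ∫⁻ ω, ENNReal.ofReal A * (b ω + ENNReal.ofReal (FPCR.pen θ σ n m)
          + ENNReal.ofReal (2 / n * ‖β‖ ^ 2) + ENNReal.ofReal (3 / n) * T ω) ∂P := by
        refine lintegral_mono_ae ?_
        filter_upwards [hsel] with ω hω
        exact (heigHat _).selected_loss_le hn hθ (fun i : Fin n => ε i ω) β hω hm1 hmn
    _ = ENNReal.ofReal A * (∫⁻ ω, b ω ∂P + ENNReal.ofReal (FPCR.pen θ σ n m)
          + ENNReal.ofReal (2 / n * ‖β‖ ^ 2) + ENNReal.ofReal (3 / n) * ∫⁻ ω, T ω ∂P) := by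
        rw [lintegral_const_mul' _ _ ENNReal.ofReal_ne_top,
          lintegral_add_right _ (hTm.const_mul _), lintegral_add_right _ measurable_const,
          lintegral_add_right _ measurable_const, lintegral_const_mul _ hTm]
        simp
    _ ≤ ENNReal.ofReal A * (∫⁻ ω, b ω ∂P + ENNReal.ofReal (FPCR.pen θ σ n m)
          + ENNReal.ofReal (2 / n * ‖β‖ ^ 2)
          + ENNReal.ofReal (3 / n) * ENNReal.ofReal (K * r)) := by gcongr
    _ = ENNReal.ofReal A * (∫⁻ ω, b ω ∂P + ENNReal.ofReal (FPCR.pen θ σ n m))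
          + ENNReal.ofReal A * (ENNReal.ofReal (2 / n * ‖β‖ ^ 2)
          + ENNReal.ofReal (3 / n) * ENNReal.ofReal (K * r)) := by
        rw [add_assoc, mul_add]
    _ ≤ _ := add_le_add_right hconst _
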